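/- Conventions. All Hilbert spaces are complex and arbitrary (not necessarily separable). $B(H,K)$ denotes the bounded operators from $H$ to $K$, with its $w^*$-topology (the ultraweak topology, given by the functionals $T\mapsto\sum_n\langle T\xi_n,\eta_n\rangle$ with $\sum_n\|\xi_n\|^2<\infty$, $\sum_n\|\eta_n\|^2<\infty$), and $[\,\cdot\,]^{-w^*}$ denotes the $w^*$-closed linear span. A subspace $\mathcal X\subseteq B(H_1,H_2)$ acts nondegenerately if the vectors $x\xi$ ($x\in\mathcal X$, $\xi\in H_1$) span a dense subspace of $H_2$ and the vectors $x^*\eta$ ($x\in\mathcal X$, $\eta\in H_2$) span a dense subspace of $H_1$. A ternary ring of operators (TRO) is a linear subspace $\mathcal M\subseteq B(H,K)$ with $\mathcal M\mathcal M^*\mathcal M\subseteq\mathcal M$. Two $w^*$-closed subspaces $\mathcal X\subseteq B(H_1,H_2)$ and $\mathcal Y\subseteq B(K_1,K_2)$ are TRO-equivalent if there are TROs $\mathcal M_1\subseteq B(H_1,K_1)$ and $\mathcal M_2\subseteq B(H_2,K_2)$ with $\mathcal Y=[\mathcal M_2\mathcal X\mathcal M_1^*]^{-w^*}$ and $\mathcal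 X=[\mathcal M_2^*\mathcal Y\mathcal M_1]^{-w^*}$. For a cardinal $J$, $\ell^2_J$ is the Hilbert space of square-summable complex families indexed by $J$, $M_J=B(\ell^2_J)$, $\otimes$ between Hilbert spaces is the Hilbert space tensor product, and for a $w^*$-closed $\mathcal X\subseteq B(H_1,H_2)$, $\mathcal X\bar\otimes M_J\subseteq B(H_1\otimes\ell^2_J,H_2\otimes\ell^2_J)$ is the $w^*$-closed linear span of the operators $x\otimes a$ with $x\in\mathcal X$, $a\in M_J$. The spaces $\mathcal X$ and $\mathcal Y$ are stably isomorphic if for some cardinal $J\neq 0$ there is a linear bijection $\mathcal X\bar\otimes M_J\to\mathcal Y\bar\otimes M_J$ that is completely isometric and a $w^*$-homeomorphism. **Theorem.** Let $\mathcal X\subseteq B(H_1,H_2)$ and $\mathcal Y\subseteq B(K_1,K_2)$ be $w^*$-closed subspaces that act nondegenerately and are TRO-equivalent. Then there exist an infinite cardinal $J$ and unitary operators $U_i\colon H_i\otimes\ell^2_J\to K_i\otimes\ell^2_J$, $i=1,2$, such that $$\mathcal Y\bar\otimes M_J=U_2(\mathcal X\bar\otimes M_J)U_1^*,$$ and the map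 $T\mapsto U_2TU_1^*$ is a completely isometric, $w^*$-homeomorphic linear bijection of $\mathcal X\bar\otimes M_J$ onto $\mathcal Y\bar\otimes M_J$. In particular, $\mathcal X$ and $\mathcal Y$ are stably isomorphic. -/

import Mathlib

open scoped TensorProduct InnerProductSpace

universe u₁ u₂ v₁ v₂

namespace TROStable

noncomputable section

/-! ### The weak* topology of `B(H, K)` -/

section WeakStar

variable {H K : Type*}
  [NormedAddCommGroup H] [InnerProductSpace ℂ H]
  [NormedAddCommGroup K] [InnerProductSpace ℂ K]

theorem summable_sq {H : Type*} [NormedAddCommGroup H] (ξ : lp (fun _ : ℕ => H) 2) : Summable fun n => ‖ξ n‖ ^ 2 := by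
  have h := (lp.memℓp ξ).summable (by norm_num)
  simpa using h

theorem summable_normalFunctional (ξ : lp (fun _ : ℕ => H) 2) (η : lp (fun _ : ℕ => K) 2)
    (T : H →L[ℂ] K) : Summable fun n => ⟪η n, T (ξ n)⟫_ℂ := by
  refine Summable.of_norm_bounded (((summable_sq ξ).add (summable_sq η)).mul_left ‖T‖) fun n => ?_
  have h1 : ‖⟪η n, T (ξ n)⟫_ℂ‖ ≤ ‖η n‖ * (‖T‖ * ‖ξ n‖) :=
    (norm_inner_le_norm _ _).trans (mul_le_mul_of_nonneg_left (T.le_opNorm _) (norm_nonneg _))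
  have h2 : ‖η n‖ * ‖ξ n‖ ≤ ‖ξ n‖ ^ 2 + ‖η n‖ ^ 2 := by
    nlinarith [sq_nonneg (‖ξ n‖ - ‖η n‖), sq_nonneg (‖ξ n‖), sq_nonneg (‖η n‖)]
  calc ‖⟪η n, T (ξ n)⟫_ℂ‖ ≤ ‖T‖ * (‖η n‖ * ‖ξ n‖) := by linarith
    _ ≤ ‖T‖ * (‖ξ n‖ ^ 2 + ‖η n‖ ^ 2) := mul_le_mul_of_nonneg_left h2 (norm_nonneg _)

/-- The functional `T ↦ ∑ₙ ⟨T ξₙ, ηₙ⟩` on `B(H, K)` for square-summable sequences `(ξₙ)` in `H`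
and `(ηₙ)` in `K`. As `(ξₙ)` and `(ηₙ)` vary, these are exactly the functionals
`T ↦ Tr(T S)` with `S : K → H` of trace class, that is, the elements of the predual. -/
def normalFunctional (ξ : lp (fun _ : ℕ => H) 2) (η : lp (fun _ : ℕ => K) 2) :
    (H →L[ℂ] K) →ₗ[ℂ] ℂ where
  toFun T := ∑' n, ⟪η n, T (ξ n)⟫_ℂ
  map_add' S T := by
    rw [← (summable_normalFunctional ξ η S).tsum_add (summable_normalFunctional ξ η T)]
    simp
  map_smul' c T := by
    simp [tsum_mul_left]

variable (H K) in
/-- The weak* (ultraweak, or σ-weak) topology of `B(H, K)`. -/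
@[reducible] def weakStarTopology : TopologicalSpace (H →L[ℂ] K) :=
  ⨅ (ξ : lp (fun _ : ℕ => H) 2) (η : lp (fun _ : ℕ => K) 2),
    TopologicalSpace.induced (normalFunctional ξ η) inferInstance

theorem continuousAdd_weakStar : @ContinuousAdd (H →L[ℂ] K) (weakStarTopology H K) _ :=
  continuousAdd_iInf fun ξ => continuousAdd_iInf fun η => continuousAdd_induced (normalFunctional ξ η)

theorem continuousSMul_weakStar : @ContinuousSMul ℂ (H →L[ℂ] K) _ _ (weakStarTopology H K) :=
  continuousSMul_iInf fun ξ => continuousSMul_iInf fun η =>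
    continuousSMul_induced (normalFunctional ξ η)

/-- The subspace `X` of `B(H, K)` is weak*-closed. -/
def IsWeakStarClosed (X : Submodule ℂ (H →L[ℂ] K)) : Prop :=
  @IsClosed _ (weakStarTopology H K) (X : Set (H →L[ℂ] K))

/-- The weak*-closed linear span of a set of operators. -/
def weakStarSpan (S : Set (H →L[ℂ] K)) : Submodule ℂ (H →L[ℂ] K) :=
  letI := weakStarTopology H K
  haveI := continuousAdd_weakStar (H := H) (K := K)
  haveI := continuousSMul_weakStar (H := H) (K := K)
  (Submodule.span ℂ S).topologicalClosure

theorem coe_weakStarSpan (S : Set (H →L[ℂ] K)) :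
    (weakStarSpan S : Set (H →L[ℂ] K)) =
      @closure _ (weakStarTopology H K) (Submodule.span ℂ S : Set (H →L[ℂ] K)) := rfl

/-- The weak* topology of a (weak*-closed) subspace of `B(H, K)`: the relative one. -/
@[reducible] def relWeakStarTopology (X : Submodule ℂ (H →L[ℂ] K)) : TopologicalSpace X :=
  (weakStarTopology H K).induced Subtype.val

end WeakStar

/-! ### Nondegenerate subspaces, ternary rings of operators, TRO-equivalence -/

section TRO

variable {H₁ H₂ K₁ K₂ : Type*}
  [NormedAddCommGroup H₁] [InnerProductSpace ℂ H₁] [CompleteSpace H₁]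
  [NormedAddCommGroup H₂] [InnerProductSpace ℂ H₂] [CompleteSpace H₂]
  [NormedAddCommGroup K₁] [InnerProductSpace ℂ K₁] [CompleteSpace K₁]
  [NormedAddCommGroup K₂] [InnerProductSpace ℂ K₂] [CompleteSpace K₂]

/-- `X ⊆ B(H₁, H₂)` acts nondegenerately: `[X H₁]` is dense in `H₂` and `[X* H₂]` in `H₁`. -/
def ActsNondegenerately (X : Submodule ℂ (H₁ →L[ℂ] H₂)) : Prop :=
  (Submodule.span ℂ {v : H₂ | ∃ x ∈ X, ∃ ξ : H₁, v = x ξ}).topologicalClosure = ⊤ ∧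
  (Submodule.span ℂ {v : H₁ | ∃ x ∈ X, ∃ η : H₂,
    v = ContinuousLinearMap.adjoint x η}).topologicalClosure = ⊤

/-- A ternary ring of operators: a subspace `M` of `B(H₁, K₁)` with `M M* M ⊆ M`. -/
def IsTRO (M : Submodule ℂ (H₁ →L[ℂ] K₁)) : Prop :=
  ∀ a ∈ M, ∀ b ∈ M, ∀ c ∈ M, a ∘L ContinuousLinearMap.adjoint b ∘L c ∈ M

/-- TRO-equivalence of subspaces `X ⊆ B(H₁, H₂)` and `Y ⊆ B(K₁, K₂)`: there are TROs
`M₁ ⊆ B(H₁, K₁)` and `M₂ ⊆ B(H₂, K₂)` such that `Y` is the weak*-closed span of `M₂ X M₁*` and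
`X` is the weak*-closed span of `M₂* Y M₁`. -/
def TROEquivalent (X : Submodule ℂ (H₁ →L[ℂ] H₂)) (Y : Submodule ℂ (K₁ →L[ℂ] K₂)) : Prop :=
  ∃ (M₁ : Submodule ℂ (H₁ →L[ℂ] K₁)) (M₂ : Submodule ℂ (H₂ →L[ℂ] K₂)),
    IsTRO M₁ ∧ IsTRO M₂ ∧
    Y = weakStarSpan {T | ∃ b ∈ M₂, ∃ x ∈ X, ∃ a ∈ M₁,
      T = b ∘L x ∘L ContinuousLinearMap.adjoint a} ∧
    X = weakStarSpan {T | ∃ b ∈ M₂, ∃ y ∈ Y, ∃ a ∈ M₁,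
      T = ContinuousLinearMap.adjoint b ∘L y ∘L a}

end TRO

/-! ### Hilbert space tensor products and the normal spatial tensor product with `M_J` -/

section Tensor

/-- The Hilbert space tensor product: the completion of the algebraic tensor product in the
inner product `⟨h ⊗ k, h' ⊗ k'⟩ = ⟨h, h'⟩⟨k, k'⟩`. -/
abbrev HilbertTensor (H K : Type*) [NormedAddCommGroup H] [InnerProductSpace ℂ H]
    [NormedAddCommGroup K] [InnerProductSpace ℂ K] : Type _ :=
  UniformSpace.Completion (H ⊗[ℂ] K)

/-- The Hilbert space `ℓ²_J` of square-summable complex families indexed by `J`. -/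
abbrev ellTwo (J : Type*) : Type _ := lp (fun _ : J => ℂ) 2

/-- `M_J`, the `J × J` complex matrices with uniformly bounded finite submatrices, that is, the
bounded operators on `ℓ²_J`. -/
abbrev MatrixSpace (J : Type*) : Type _ := ellTwo J →L[ℂ] ellTwo J

variable {H₁ H₂ L₁ L₂ : Type*}
  [NormedAddCommGroup H₁] [InnerProductSpace ℂ H₁] [NormedAddCommGroup H₂] [InnerProductSpace ℂ H₂]
  [NormedAddCommGroup L₁] [InnerProductSpace ℂ L₁] [NormedAddCommGroup L₂] [InnerProductSpace ℂ L₂]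

/-- The bounded operator `x ⊗ a` between Hilbert space tensor products. -/
def tensorOp (x : H₁ →L[ℂ] H₂) (a : L₁ →L[ℂ] L₂) :
    HilbertTensor H₁ L₁ →L[ℂ] HilbertTensor H₂ L₂ :=
  (TensorProduct.mapL x a).completion

theorem tensorOp_tmul (x : H₁ →L[ℂ] H₂) (a : L₁ →L[ℂ] L₂) (h : H₁) (l : L₁) :
    tensorOp x a ((h ⊗ₜ[ℂ] l : H₁ ⊗[ℂ] L₁) : HilbertTensor H₁ L₁) =
      ((x h ⊗ₜ[ℂ] a l : H₂ ⊗[ℂ] L₂) : HilbertTensor H₂ L₂) := by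
  simp [tensorOp]

/-- The normal spatial tensor product of `X ⊆ B(H₁, H₂)` with `M_J`: the weak*-closed linear span
in `B(H₁ ⊗ ℓ²_J, H₂ ⊗ ℓ²_J)` of the operators `x ⊗ a` with `x ∈ X` and `a ∈ M_J`. -/
def stabilization (X : Submodule ℂ (H₁ →L[ℂ] H₂)) (J : Type*) :
    Submodule ℂ (HilbertTensor H₁ (ellTwo J) →L[ℂ] HilbertTensor H₂ (ellTwo J)) :=
  weakStarSpan {T | ∃ x ∈ X, ∃ a : MatrixSpace J, T = tensorOp x a}

end Tensor

/-! ### Completely isometric weak*-homeomorphic isomorphisms, stable isomorphism -/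

section Iso

/-- The operator from the Hilbert sum `H₁ⁿ` to `H₂ⁿ` given by an `n × n` matrix of operators. -/
def matrixOp {H₁ H₂ : Type*} [NormedAddCommGroup H₁] [InnerProductSpace ℂ H₁]
    [NormedAddCommGroup H₂] [InnerProductSpace ℂ H₂] {n : ℕ}
    (T : Matrix (Fin n) (Fin n) (H₁ →L[ℂ] H₂)) :
    PiLp 2 (fun _ : Fin n => H₁) →L[ℂ] PiLp 2 (fun _ : Fin n => H₂) :=
  (PiLp.continuousLinearEquiv 2 ℂ (fun _ : Fin n => H₂)).symm.toContinuousLinearMap ∘L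
    ContinuousLinearMap.pi fun i => ∑ j, T i j ∘L PiLp.proj 2 (fun _ : Fin n => H₁) j

theorem matrixOp_apply {H₁ H₂ : Type*} [NormedAddCommGroup H₁] [InnerProductSpace ℂ H₁]
    [NormedAddCommGroup H₂] [InnerProductSpace ℂ H₂] {n : ℕ}
    (T : Matrix (Fin n) (Fin n) (H₁ →L[ℂ] H₂)) (v : PiLp 2 (fun _ : Fin n => H₁)) (i : Fin n) :
    matrixOp T v i = ∑ j, T i j (v j) := by
  simp [matrixOp]

variable {H₁ H₂ K₁ K₂ : Type*}
  [NormedAddCommGroup H₁] [InnerProductSpace ℂ H₁] [NormedAddCommGroup H₂] [InnerProductSpace ℂ H₂]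
  [NormedAddCommGroup K₁] [InnerProductSpace ℂ K₁] [NormedAddCommGroup K₂] [InnerProductSpace ℂ K₂]

/-- The operator `U₂ T U₁*`, for unitaries `U₁ : H₁ → K₁` and `U₂ : H₂ → K₂`. -/
def unitaryConj [CompleteSpace H₁] [CompleteSpace K₁] (U₁ : H₁ ≃ₗᵢ[ℂ] K₁) (U₂ : H₂ ≃ₗᵢ[ℂ] K₂)
    (T : H₁ →L[ℂ] H₂) : K₁ →L[ℂ] K₂ :=
  (U₂ : H₂ →L[ℂ] K₂) ∘L T ∘L ContinuousLinearMap.adjoint (U₁ : H₁ →L[ℂ] K₁)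

/-- `φ` is completely isometric: every amplification `Mₙ(X) → Mₙ(Y)` preserves the norm, where
`Mₙ(B(H₁, H₂))` is normed as `B(H₁ⁿ, H₂ⁿ)`. -/
def IsCompletelyIsometric {X : Submodule ℂ (H₁ →L[ℂ] H₂)} {Y : Submodule ℂ (K₁ →L[ℂ] K₂)}
    (φ : X ≃ₗ[ℂ] Y) : Prop :=
  ∀ (n : ℕ) (T : Matrix (Fin n) (Fin n) X),
    ‖matrixOp (T.map fun x => (φ x : K₁ →L[ℂ] K₂))‖ =
      ‖matrixOp (T.map fun x => (x : H₁ →L[ℂ] H₂))‖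

/-- `φ` is an isomorphism of dual operator spaces: completely isometric and a homeomorphism for the
weak* topologies. -/
def IsDualOperatorSpaceIso {X : Submodule ℂ (H₁ →L[ℂ] H₂)} {Y : Submodule ℂ (K₁ →L[ℂ] K₂)}
    (φ : X ≃ₗ[ℂ] Y) : Prop :=
  IsCompletelyIsometric φ ∧
    @IsHomeomorph X Y (relWeakStarTopology X) (relWeakStarTopology Y) φ

end Iso

/-- The weak*-closed spaces `X` and `Y` are stably isomorphic: for some nonzero cardinal `J`, the
spaces `X ⊗̄ M_J` and `Y ⊗̄ M_J` are isomorphic completely isometrically and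
weak*-homeomorphically. -/
def StablyIsomorphic {H₁ : Type u₁} {H₂ : Type u₂} {K₁ : Type v₁} {K₂ : Type v₂}
    [NormedAddCommGroup H₁] [InnerProductSpace ℂ H₁]
    [NormedAddCommGroup H₂] [InnerProductSpace ℂ H₂]
    [NormedAddCommGroup K₁] [InnerProductSpace ℂ K₁]
    [NormedAddCommGroup K₂] [InnerProductSpace ℂ K₂]
    (X : Submodule ℂ (H₁ →L[ℂ] H₂)) (Y : Submodule ℂ (K₁ →L[ℂ] K₂)) : Prop :=
  ∃ (J : Type (max u₁ u₂ v₁ v₂)) (_ : Nonempty J) (φ : stabilization X J ≃ₗ[ℂ] stabilization Y J),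
    IsDualOperatorSpaceIso φ

end

end TROStable

open TROStable

open Filter Topology ContinuousLinearMap

namespace TROStable

/-! ### Weak* closures: continuity of multiplication and adjoint, bounded weak operator limits -/

section WeakStarTools

variable {H K H' K' : Type*}
  [NormedAddCommGroup H] [InnerProductSpace ℂ H]
  [NormedAddCommGroup K] [InnerProductSpace ℂ K]
  [NormedAddCommGroup H'] [InnerProductSpace ℂ H']
  [NormedAddCommGroup K'] [InnerProductSpace ℂ K']

/-! Let `N₁`, `N₂` be the weak*-closures of the TROs implementing the equivalence. Multiplication is
separately weak*-continuous and the adjoint is weak*-continuous, so the `Nᵢ` are again TROs with `N₂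
X N₁* ⊆ Y` and `N₂* Y N₁ ⊆ X`. It suffices to find a unitary `Uᵢ` in each `Nᵢ ⊗̄ M_J`: the two
inclusions pass to the stabilizations and give `U₂ (X ⊗̄ M_J) U₁* ⊆ Y ⊗̄ M_J` together with the
reverse inclusion.

Nondegeneracy of `X` and `Y` forces the elements of `Nᵢ`, and likewise their adjoints, to have
trivial common kernel. For such a TRO `N ⊆ B(H, K)`, a maximal family in `N` with `∑ m* m ≤ 1` must
have sum `1` (`exists_partition`): otherwise a multiple of some `m (1 - ∑ m* m)` could be added. The
family is a column isometry from `H` to a multiple of `K`. Using `J × J ≃ J` to give each coordinate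
of `H ⊗ ℓ²_J` its own block of coordinates of `K ⊗ ℓ²_J`, one gets an isometry `u` in `N ⊗̄ M_J`
(`exists_isometry_entries`, `mem_stabilization_of_entries`). The same construction for `N*` gives an
isometry `v` in the opposite direction with `v*` in `N ⊗̄ M_J`.

Finally `exists_unitary_mem` runs the Schröder–Bernstein argument for `u` and `v`. The projection
that it needs is a series of products of `u`, `v` and their adjoints, and right multiplication by it
preserves the TRO, so the resulting unitary stays in `N ⊗̄ M_J`. -/

theorem subset_weakStarSpan (S : Set (H →L[ℂ] K)) : S ⊆ weakStarSpan S := by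
  let _ := weakStarTopology H K
  rw [coe_weakStarSpan]
  exact Submodule.subset_span.trans subset_closure

theorem isWeakStarClosed_weakStarSpan (S : Set (H →L[ℂ] K)) :
    IsWeakStarClosed (weakStarSpan S) := by
  let _ := weakStarTopology H K
  unfold IsWeakStarClosed
  rw [coe_weakStarSpan]
  exact isClosed_closure

theorem weakStarSpan_le {S : Set (H →L[ℂ] K)} {Z : Submodule ℂ (H →L[ℂ] K)}
    (hZ : IsWeakStarClosed Z) (h : S ⊆ Z) : weakStarSpan S ≤ Z := by
  let _ := weakStarTopology H K
  intro x hx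
  have hx' : x ∈ (weakStarSpan S : Set (H →L[ℂ] K)) := hx
  rw [coe_weakStarSpan] at hx'
  exact closure_minimal (Submodule.span_le.2 h) hZ hx'

theorem continuous_normalFunctional (ξ : lp (fun _ : ℕ => H) 2) (η : lp (fun _ : ℕ => K) 2) :
    @Continuous _ _ (weakStarTopology H K) _ (normalFunctional ξ η) :=
  continuous_iInf_dom (i := ξ) (continuous_iInf_dom (i := η) continuous_induced_dom)

theorem continuous_weakStar_rng {α : Type*} [TopologicalSpace α] {f : α → (H →L[ℂ] K)}
    (h : ∀ ξ η, Continuous fun a => normalFunctional ξ η (f a)) :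
    @Continuous _ _ _ (weakStarTopology H K) f :=
  continuous_iInf_rng.2 fun ξ => continuous_iInf_rng.2 fun η => continuous_induced_rng.2 (h ξ η)

/-- The coordinatewise image of a square-summable sequence under a bounded operator. -/
noncomputable def mapSeq (A : H →L[ℂ] K) (ξ : lp (fun _ : ℕ => H) 2) :
    lp (fun _ : ℕ => K) 2 :=
  ⟨fun n => A (ξ n), by
    refine memℓp_gen ?_
    have h := (summable_sq ξ).mul_left (‖A‖ ^ 2)
    refine Summable.of_nonneg_of_le (fun n => by positivity) (fun n => ?_) h
    have := A.le_opNorm (ξ n)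
    simp only [ENNReal.toReal_ofNat, Real.rpow_ofNat]
    rw [← mul_pow]
    gcongr⟩

@[simp] theorem mapSeq_apply (A : H →L[ℂ] K) (ξ : lp (fun _ : ℕ => H) 2) (n : ℕ) :
    mapSeq A ξ n = A (ξ n) := rfl

/-- Pulling back the normal functional of `(ξ, η)` along `T ↦ A T B` gives the normal functional of
`(B ξ, A* η)`. -/
theorem continuous_weakStar_comp_comp [CompleteSpace K] [CompleteSpace K']
    (A : K →L[ℂ] K') (B : H' →L[ℂ] H) :
    @Continuous _ _ (weakStarTopology H K) (weakStarTopology H' K')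
      fun T : H →L[ℂ] K => A ∘L T ∘L B := by
  let _ := weakStarTopology H K
  refine continuous_weakStar_rng fun ξ η => ?_
  convert continuous_normalFunctional (mapSeq B ξ) (mapSeq (adjoint A) η) using 2 with T
  simp [normalFunctional, adjoint_inner_left]

theorem continuous_weakStar_adjoint [CompleteSpace H] [CompleteSpace K] :
    @Continuous _ _ (weakStarTopology H K) (weakStarTopology K H)
      fun T : H →L[ℂ] K => adjoint T := by
  let _ := weakStarTopology H K
  refine continuous_weakStar_rng fun ξ η => ?_
  convert (continuous_normalFunctional η ξ).star using 2 with T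
  simp [normalFunctional, adjoint_inner_right, tsum_star]

/-- The operators `t` with `A t B ∈ Z` form a weak*-closed subspace, so it is enough to test
generators. This is how algebraic inclusions are extended to weak*-closures, one factor at a time.
-/
theorem comp_mem_of_mem_weakStarSpan [CompleteSpace K] [CompleteSpace K']
    {S : Set (H →L[ℂ] K)} {Z : Submodule ℂ (H' →L[ℂ] K')} (hZ : IsWeakStarClosed Z)
    (A : K →L[ℂ] K') (B : H' →L[ℂ] H) (h : ∀ s ∈ S, A ∘L s ∘L B ∈ Z)
    {t : H →L[ℂ] K} (ht : t ∈ weakStarSpan S) : A ∘L t ∘L B ∈ Z := by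
  let W : Submodule ℂ (H →L[ℂ] K) :=
    { carrier := {t | A ∘L t ∘L B ∈ Z}
      zero_mem' := by simp
      add_mem' := fun {a b} ha hb => by
        have := Z.add_mem ha hb
        simpa [comp_add, add_comp] using this
      smul_mem' := fun c a ha => by
        have := Z.smul_mem c ha
        simpa [comp_smul, smul_comp] using this }
  have hW : IsWeakStarClosed W := by
    let _ := weakStarTopology H K
    let _ := weakStarTopology H' K'
    exact IsClosed.preimage (continuous_weakStar_comp_comp A B) hZ
  exact weakStarSpan_le hW h ht

theorem comp_adjoint_mem_of_mem_weakStarSpan [CompleteSpace H] [CompleteSpace K]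
    [CompleteSpace K']
    {S : Set (H →L[ℂ] K)} {Z : Submodule ℂ (H' →L[ℂ] K')} (hZ : IsWeakStarClosed Z)
    (A : H →L[ℂ] K') (B : H' →L[ℂ] K) (h : ∀ s ∈ S, A ∘L adjoint s ∘L B ∈ Z)
    {t : H →L[ℂ] K} (ht : t ∈ weakStarSpan S) : A ∘L adjoint t ∘L B ∈ Z := by
  let W : Submodule ℂ (H →L[ℂ] K) :=
    { carrier := {t | A ∘L adjoint t ∘L B ∈ Z}
      zero_mem' := by simp
      add_mem' := fun {a b} ha hb => by
        have := Z.add_mem ha hb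
        simpa [comp_add, add_comp] using this
      smul_mem' := fun c a ha => by
        have := Z.smul_mem (star c) ha
        simpa [comp_smul, smul_comp, map_smulₛₗ] using this }
  have hW : IsWeakStarClosed W := by
    let _ := weakStarTopology H K
    let _ := weakStarTopology K H
    let _ := weakStarTopology H' K'
    exact IsClosed.preimage ((continuous_weakStar_comp_comp A B).comp continuous_weakStar_adjoint)
      hZ
  exact weakStarSpan_le hW h ht

/-- A weak*-closed subspace contains the weak operator limits of its bounded nets. -/
theorem IsWeakStarClosed.mem_of_tendsto_inner {Z : Submodule ℂ (H →L[ℂ] K)}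
    (hZ : IsWeakStarClosed Z) {ι : Type*} {l : Filter ι} [l.NeBot] {T : ι → H →L[ℂ] K}
    {S : H →L[ℂ] K} (C : ℝ) (hC : ∀ i, ‖T i‖ ≤ C) (hT : ∀ i, T i ∈ Z)
    (h : ∀ ξ η, Tendsto (fun i => ⟪η, T i ξ⟫_ℂ) l (𝓝 ⟪η, S ξ⟫_ℂ)) : S ∈ Z := by
  -- On a bounded net, weak operator convergence implies weak* convergence: the terms of each normal
  -- functional are dominated by one summable sequence.
  have key : Tendsto T l (@nhds _ (weakStarTopology H K) S) := by
    simp only [nhds_iInf, nhds_induced, tendsto_iInf, tendsto_comap_iff]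
    intro ξ η
    refine tendsto_tsum_of_dominated_convergence
      (bound := fun n => C * (‖ξ n‖ ^ 2 + ‖η n‖ ^ 2))
      (((summable_sq ξ).add (summable_sq η)).mul_left C) (fun n => h _ _)
      (Eventually.of_forall fun i n => ?_)
    have h0 := hC i
    have h1 : ‖⟪η n, T i (ξ n)⟫_ℂ‖ ≤ ‖η n‖ * (C * ‖ξ n‖) :=
      (norm_inner_le_norm _ _).trans (mul_le_mul_of_nonneg_left
        (((T i).le_opNorm _).trans (by gcongr)) (norm_nonneg _))
    have hC0 : 0 ≤ C := (norm_nonneg _).trans h0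
    have h2 : ‖η n‖ * ‖ξ n‖ ≤ ‖ξ n‖ ^ 2 + ‖η n‖ ^ 2 := by
      nlinarith [sq_nonneg (‖ξ n‖ - ‖η n‖), sq_nonneg (‖ξ n‖), sq_nonneg (‖η n‖)]
    calc ‖⟪η n, T i (ξ n)⟫_ℂ‖ ≤ C * (‖η n‖ * ‖ξ n‖) := by linarith
      _ ≤ _ := mul_le_mul_of_nonneg_left h2 hC0
  let _ := weakStarTopology H K
  exact IsClosed.mem_of_tendsto hZ key (Eventually.of_forall hT)

end WeakStarTools

/-! ### Columns of operators and partitions of the identity in a TRO -/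

section Columns

variable {H K H' K' : Type*}
  [NormedAddCommGroup H] [InnerProductSpace ℂ H] [CompleteSpace H]
  [NormedAddCommGroup K] [InnerProductSpace ℂ K] [CompleteSpace K]
  [NormedAddCommGroup H'] [InnerProductSpace ℂ H'] [CompleteSpace H']
  [NormedAddCommGroup K'] [InnerProductSpace ℂ K'] [CompleteSpace K']
  {ι : Type*}

theorem hasSum_norm_sq {K : Type*} [NormedAddCommGroup K] (x : lp (fun _ : ι => K) 2) : HasSum (fun j => ‖x j‖ ^ 2) (‖x‖ ^ 2) := by
  have h := lp.hasSum_norm (p := 2) (by norm_num) x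
  simpa using h

omit [CompleteSpace H] [CompleteSpace K] in
/-- A family of operators `t j` with `∑ ‖t j ξ‖² ≤ ‖ξ‖²` assembles to a column contraction. -/
theorem exists_column (t : ι → H →L[ℂ] K)
    (h : ∀ (F : Finset ι) (ξ : H), ∑ j ∈ F, ‖t j ξ‖ ^ 2 ≤ ‖ξ‖ ^ 2) :
    ∃ T : H →L[ℂ] lp (fun _ : ι => K) 2, (∀ ξ j, T ξ j = t j ξ) ∧ ∀ ξ, ‖T ξ‖ ≤ ‖ξ‖ := by
  have hmem : ∀ ξ : H, Memℓp (fun j => t j ξ) 2 := fun ξ =>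
    memℓp_gen (by
      simpa using summable_of_sum_le (fun j => by positivity) (fun F => h F ξ))
  let T₀ : H →ₗ[ℂ] lp (fun _ : ι => K) 2 :=
    { toFun := fun ξ => ⟨fun j => t j ξ, hmem ξ⟩
      map_add' := fun a b => Subtype.ext (funext fun j => map_add (t j) a b)
      map_smul' := fun c a => by ext j; simp }
  have hT₀ : ∀ ξ, ‖T₀ ξ‖ ≤ 1 * ‖ξ‖ := fun ξ => by
    rw [one_mul]
    refine le_of_sq_le_sq ?_ (norm_nonneg _)
    exact hasSum_le_of_sum_le (hasSum_norm_sq (T₀ ξ)) fun F => h F ξ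
  exact ⟨T₀.mkContinuous 1 hT₀, fun _ _ => rfl, fun ξ => by simpa using hT₀ ξ⟩

theorem hasSum_inner_column {t : ι → H →L[ℂ] K} {T : H →L[ℂ] lp (fun _ : ι => K) 2}
    (hT : ∀ ξ j, T ξ j = t j ξ) (η ξ : H) :
    HasSum (fun j => ⟪t j η, t j ξ⟫_ℂ) ⟪η, adjoint T (T ξ)⟫_ℂ := by
  have h := lp.hasSum_inner (𝕜 := ℂ) (T η) (T ξ)
  simpa [hT, adjoint_inner_right] using h

omit [CompleteSpace H'] in
-- `T* T` is the weak operator limit of the finite sums of `t j* t j`, which are contractions, so a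
-- weak*-closed `Z` containing each `A (t j* t j) B` also contains the limit.
theorem comp_column_mem {t : ι → H →L[ℂ] K} {T : H →L[ℂ] lp (fun _ : ι => K) 2}
    (hT : ∀ ξ j, T ξ j = t j ξ) (hT1 : ∀ ξ, ‖T ξ‖ ≤ ‖ξ‖)
    {Z : Submodule ℂ (H' →L[ℂ] K')} (hZ : IsWeakStarClosed Z)
    (A : H →L[ℂ] K') (B : H' →L[ℂ] H) (h : ∀ j, A ∘L (adjoint (t j) ∘L t j) ∘L B ∈ Z) :
    A ∘L (adjoint T ∘L T) ∘L B ∈ Z := by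
  classical
  have hsum : ∀ (F : Finset ι) (ξ : H), ∑ j ∈ F, ‖t j ξ‖ ^ 2 ≤ ‖ξ‖ ^ 2 := fun F ξ => by
    have h1 := sum_le_hasSum F (fun j _ => by positivity) (hasSum_norm_sq (T ξ))
    simp only [hT] at h1
    exact h1.trans (by gcongr; exact hT1 ξ)
  -- For `y = ∑ t j* t j ξ`, Cauchy–Schwarz and `ab ≤ (a² + b²)/2` give `‖y‖² ≤ (‖y‖² + ‖ξ‖²)/2`,
  -- hence `‖y‖ ≤ ‖ξ‖`.
  have hbd : ∀ F : Finset ι, ‖∑ j ∈ F, adjoint (t j) ∘L t j‖ ≤ 1 := fun F => by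
    refine opNorm_le_bound _ zero_le_one fun ξ => ?_
    rw [one_mul]
    set y := (∑ j ∈ F, adjoint (t j) ∘L t j) ξ with hy
    have h1 : (‖y‖ : ℂ) ^ 2 = ∑ j ∈ F, ⟪t j y, t j ξ⟫_ℂ := by
      rw [← RCLike.ofReal_eq_complex_ofReal, ← inner_self_eq_norm_sq_to_K (𝕜 := ℂ)]
      calc ⟪y, y⟫_ℂ = ⟪y, (∑ j ∈ F, adjoint (t j) ∘L t j) ξ⟫_ℂ := by rw [← hy]
        _ = _ := by simp only [sum_apply, inner_sum, comp_apply, adjoint_inner_right]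
    have h2 : ‖y‖ ^ 2 ≤ ∑ j ∈ F, (‖t j y‖ ^ 2 + ‖t j ξ‖ ^ 2) / 2 := by
      have h3 : ‖y‖ ^ 2 = ‖∑ j ∈ F, ⟪t j y, t j ξ⟫_ℂ‖ := by rw [← h1]; simp
      rw [h3]
      refine (norm_sum_le _ _).trans (Finset.sum_le_sum fun j _ => ?_)
      refine (norm_inner_le_norm _ _).trans ?_
      nlinarith [sq_nonneg (‖t j y‖ - ‖t j ξ‖)]
    rw [← Finset.sum_div, Finset.sum_add_distrib] at h2
    refine le_of_sq_le_sq ?_ (norm_nonneg _)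
    linarith [hsum F y, hsum F ξ]
  refine hZ.mem_of_tendsto_inner (l := (atTop : Filter (Finset ι)))
    (T := fun F => A ∘L (∑ j ∈ F, adjoint (t j) ∘L t j) ∘L B) (‖A‖ * (1 * ‖B‖))
    (fun F => ?_) (fun F => ?_) fun ξ η => ?_
  · refine (opNorm_comp_le _ _).trans (mul_le_mul_of_nonneg_left ?_ (norm_nonneg _))
    exact (opNorm_comp_le _ _).trans (mul_le_mul_of_nonneg_right (hbd F) (norm_nonneg _))
  · have : A ∘L (∑ j ∈ F, adjoint (t j) ∘L t j) ∘L B =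
        ∑ j ∈ F, A ∘L (adjoint (t j) ∘L t j) ∘L B := by
      ext; simp [sum_apply]
    rw [this]
    exact Z.sum_mem fun j _ => h j
  · have h1 := hasSum_inner_column hT (adjoint A η) (B ξ)
    have h2 : ⟪η, (A ∘L (adjoint T ∘L T) ∘L B) ξ⟫_ℂ =
        ⟪adjoint A η, adjoint T (T (B ξ))⟫_ℂ := by simp [adjoint_inner_left]
    rw [h2]
    refine Tendsto.congr (fun F => ?_) h1
    simp only [comp_apply, ← adjoint_inner_left A, sum_apply, inner_sum, adjoint_inner_right]

/-- A weak*-closed TRO with trivial common kernel contains a family with `∑ m* m = 1`. -/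
theorem exists_partition {N : Submodule ℂ (H →L[ℂ] K)} (hN : IsWeakStarClosed N) (hTRO : IsTRO N)
    (hker : ∀ ξ : H, (∀ m ∈ N, m ξ = 0) → ξ = 0) :
    ∃ S : Set (H →L[ℂ] K), S ⊆ N ∧ ∀ ξ, HasSum (fun m : S => ‖m.1 ξ‖ ^ 2) (‖ξ‖ ^ 2) := by
  classical
  -- Bounding only finite partial sums makes the condition pass to unions of chains.
  let P : Set (Set (H →L[ℂ] K)) := {S | S ⊆ N ∧
    ∀ F : Finset (H →L[ℂ] K), ↑F ⊆ S → ∀ ξ, ∑ m ∈ F, ‖m ξ‖ ^ 2 ≤ ‖ξ‖ ^ 2}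
  obtain ⟨S, hS⟩ := zorn_subset P (by
    intro c hc hchain
    rcases c.eq_empty_or_nonempty with rfl | hne
    · refine ⟨∅, ⟨Set.empty_subset _, fun F hF ξ => ?_⟩, by simp⟩
      simp [Finset.coe_eq_empty.1 (Set.subset_empty_iff.1 hF)]
    refine ⟨⋃₀ c, ⟨Set.sUnion_subset fun s hs => (hc hs).1, fun F hF ξ => ?_⟩,
      fun s hs => Set.subset_sUnion_of_mem hs⟩
    obtain ⟨s, hs, hFs⟩ := DirectedOn.exists_mem_subset_of_finset_subset_biUnion hne
      hchain.directedOn (f := id) (s := F) (by simpa [Set.sUnion_eq_biUnion] using hF)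
    exact (hc hs).2 F hFs ξ)
  obtain ⟨⟨hSN, hSsum⟩, hmax⟩ := hS
  have hsum : ∀ (F : Finset S) (ξ : H), ∑ j ∈ F, ‖j.1 ξ‖ ^ 2 ≤ ‖ξ‖ ^ 2 := fun F ξ => by
    have := hSsum (F.map (Function.Embedding.subtype _)) (by simp) ξ
    simpa using this
  obtain ⟨T, hT, hT1⟩ := exists_column (fun j : S => j.1) hsum
  refine ⟨S, hSN, ?_⟩
  suffices hR : ∀ ξ, adjoint T (T ξ) = ξ by
    intro ξ
    have h1 := hasSum_norm_sq (T ξ)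
    simp only [hT] at h1
    have h2 : ‖T ξ‖ ^ 2 = ‖ξ‖ ^ 2 := by
      rw [← inner_self_eq_norm_sq (𝕜 := ℂ), ← adjoint_inner_right, hR, inner_self_eq_norm_sq]
    rwa [h2] at h1
  by_contra! hcon
  obtain ⟨ξ, hξ⟩ := hcon
  have hξ' : ξ - adjoint T (T ξ) ≠ 0 := sub_ne_zero.2 (Ne.symm hξ)
  obtain ⟨m, hm, hmξ⟩ : ∃ m ∈ N, m (ξ - adjoint T (T ξ)) ≠ 0 := by
    by_contra! hc
    exact hξ' (hker _ hc)
  have hm0 : 0 < ‖m‖ := norm_pos_iff.2 fun h0 => hmξ (by simp [h0])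
  -- With `R = T* T ≤ 1`, `g = ‖m‖⁻¹ m (1 - R)` satisfies `g* g ≤ (1 - R)² ≤ 1 - R`, so there is
  -- room for `g` in the family.
  let g : H →L[ℂ] K := ((‖m‖⁻¹ : ℝ) : ℂ) • (m - m ∘L adjoint T ∘L T)
  have hgN : g ∈ N := by
    refine N.smul_mem _ (N.sub_mem hm ?_)
    have := comp_column_mem hT hT1 hN m (ContinuousLinearMap.id ℂ H)
      fun j => hTRO m hm _ (hSN j.2) _ (hSN j.2)
    exact this
  have hgξ : g ξ ≠ 0 := by
    have : g ξ = ((‖m‖⁻¹ : ℝ) : ℂ) • m (ξ - adjoint T (T ξ)) := by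
      simp only [g, smul_apply, sub_apply, comp_apply, map_sub]
    rw [this]
    exact smul_ne_zero (by simpa using hm0.ne') hmξ
  have hg : ∀ ζ, ‖g ζ‖ ^ 2 ≤ ‖ζ‖ ^ 2 - ‖T ζ‖ ^ 2 := fun ζ => by
    have h1 : ‖g ζ‖ ≤ ‖ζ - adjoint T (T ζ)‖ := by
      have : g ζ = ((‖m‖⁻¹ : ℝ) : ℂ) • m (ζ - adjoint T (T ζ)) := by
        simp only [g, smul_apply, sub_apply, comp_apply, map_sub]
      rw [this, norm_smul]
      have h2 := m.le_opNorm (ζ - adjoint T (T ζ))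
      rw [Complex.norm_real, Real.norm_of_nonneg (by positivity), inv_mul_le_iff₀ hm0]
      exact h2
    have h2 : ‖ζ - adjoint T (T ζ)‖ ^ 2 ≤ ‖ζ‖ ^ 2 - ‖T ζ‖ ^ 2 := by
      have h3 : RCLike.re ⟪ζ, adjoint T (T ζ)⟫_ℂ = ‖T ζ‖ ^ 2 := by
        rw [adjoint_inner_right, inner_self_eq_norm_sq]
      have h4 : ‖adjoint T (T ζ)‖ ≤ ‖T ζ‖ := by
        have h5 : ‖adjoint T‖ ≤ 1 := by
          rw [LinearIsometryEquiv.norm_map]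
          exact opNorm_le_bound _ zero_le_one (by simpa using hT1)
        simpa using (adjoint T).le_of_opNorm_le h5 (T ζ)
      have h6 := norm_sub_sq (𝕜 := ℂ) ζ (adjoint T (T ζ))
      rw [h3] at h6
      nlinarith [norm_nonneg (adjoint T (T ζ))]
    exact (by gcongr : ‖g ζ‖ ^ 2 ≤ ‖ζ - adjoint T (T ζ)‖ ^ 2).trans h2
  -- Zorn's lemma is applied to sets, so adjoining `g` gains nothing if `g` is already in `S`.
  -- Distinct multiples `c n • g` with `1/2 ≤ c n ≤ 1` avoid this: if all were in `S`, each would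
  -- contribute at least `‖g ξ‖² / 4` to a sum bounded by `‖ξ‖²`.
  let c : ℕ → ℝ := fun n => 1 / 2 + 1 / (n + 2)
  have hc1 : ∀ n, 1 / 2 ≤ c n ∧ c n ≤ 1 := fun n => by
    have h1 : (0 : ℝ) < n + 2 := by positivity
    refine ⟨by simp only [c]; linarith [one_div_pos.2 h1], ?_⟩
    have : 1 / ((n : ℝ) + 2) ≤ 1 / 2 := by gcongr; linarith
    simp only [c]; linarith
  have hcinj : Function.Injective c := fun a b hab => by
    simp only [c, add_right_inj, one_div, inv_inj, add_left_inj, Nat.cast_inj] at hab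
    exact hab
  have hcg : Function.Injective fun n => ((c n : ℝ) : ℂ) • g := fun a b hab => by
    have hg0 : g ≠ 0 := fun h0 => hgξ (by simp [h0])
    exact hcinj (Complex.ofReal_injective (smul_left_injective ℂ hg0 hab))
  have hnorm : ∀ n ζ, ‖(((c n : ℝ) : ℂ) • g) ζ‖ = c n * ‖g ζ‖ := fun n ζ => by
    rw [smul_apply, norm_smul, Complex.norm_real,
      Real.norm_of_nonneg (by linarith [(hc1 n).1])]
  obtain ⟨n, hn⟩ : ∃ n, ((c n : ℝ) : ℂ) • g ∉ S := by
    by_contra! hall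
    obtain ⟨k, hk⟩ := exists_nat_gt (‖ξ‖ ^ 2 / (‖g ξ‖ ^ 2 / 4))
    have hpos : 0 < ‖g ξ‖ ^ 2 / 4 := by positivity
    rw [div_lt_iff₀ hpos] at hk
    have h1 := hSsum ((Finset.range k).image fun n => ((c n : ℝ) : ℂ) • g)
      (by intro x hx; simp at hx; obtain ⟨a, _, rfl⟩ := hx; exact hall a) ξ
    rw [Finset.sum_image fun a _ b _ hab => hcg hab] at h1
    have h2 : ∑ _n ∈ Finset.range k, ‖g ξ‖ ^ 2 / 4 ≤
        ∑ n ∈ Finset.range k, ‖(((c n : ℝ) : ℂ) • g) ξ‖ ^ 2 := by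
      refine Finset.sum_le_sum fun n _ => ?_
      rw [hnorm, mul_pow]
      nlinarith [(hc1 n).1, sq_nonneg ‖g ξ‖,
        mul_nonneg (sq_nonneg ‖g ξ‖) (sub_nonneg.2 (hc1 n).1)]
    rw [Finset.sum_const, Finset.card_range, nsmul_eq_mul] at h2
    linarith
  refine hn (hmax (y := insert (((c n : ℝ) : ℂ) • g) S) ⟨?_, fun F hF ζ => ?_⟩
    (Set.subset_insert _ _) (Set.mem_insert _ _))
  · exact Set.insert_subset (N.smul_mem _ hgN) hSN
  · have hF' : ∀ x ∈ F.erase (((c n : ℝ) : ℂ) • g), x ∈ S := fun x hx => by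
      rw [Finset.mem_erase] at hx
      exact (Set.mem_insert_iff.1 (hF hx.2)).resolve_left hx.1
    have h1 : ∑ m ∈ F.erase (((c n : ℝ) : ℂ) • g), ‖m ζ‖ ^ 2 ≤ ‖T ζ‖ ^ 2 := by
      rw [← Finset.sum_subtype_of_mem (p := (· ∈ S)) (fun m => ‖m ζ‖ ^ 2) hF']
      have := sum_le_hasSum ((F.erase (((c n : ℝ) : ℂ) • g)).subtype (· ∈ S))
        (fun j _ => by positivity) (hasSum_norm_sq (T ζ))
      simpa only [hT] using this
    have h2 : ∑ m ∈ F, ‖m ζ‖ ^ 2 ≤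
        ∑ m ∈ insert (((c n : ℝ) : ℂ) • g) (F.erase (((c n : ℝ) : ℂ) • g)), ‖m ζ‖ ^ 2 :=
      Finset.sum_le_sum_of_subset_of_nonneg (Finset.insert_erase_subset _ _)
        fun _ _ _ => by positivity
    rw [Finset.sum_insert (Finset.notMem_erase _ _), hnorm] at h2
    have h3 : (c n * ‖g ζ‖) ^ 2 ≤ ‖g ζ‖ ^ 2 := by
      have := hc1 n
      gcongr
      nlinarith [norm_nonneg (g ζ)]
    linarith [hg ζ]

end Columns

/-! ### Schröder–Bernstein in a weak*-closed TRO -/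

section SchroederBernstein

variable {H K : Type*}
  [NormedAddCommGroup H] [InnerProductSpace ℂ H] [CompleteSpace H]
  [NormedAddCommGroup K] [InnerProductSpace ℂ K] [CompleteSpace K]

/-- A bounded operator with `U* U = 1` and `U U* = 1` as a surjective linear isometry. -/
noncomputable def unitaryOfAdjoint (U : H →L[ℂ] K) (h1 : ∀ x, adjoint U (U x) = x)
    (h2 : ∀ y, U (adjoint U y) = y) : H ≃ₗᵢ[ℂ] K where
  toFun := U
  map_add' := map_add U
  map_smul' := map_smul U
  invFun := adjoint U
  left_inv := h1
  right_inv := h2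
  norm_map' x := by
    have : ‖U x‖ ^ 2 = ‖x‖ ^ 2 := by
      rw [← inner_self_eq_norm_sq (𝕜 := ℂ), ← adjoint_inner_right, h1, inner_self_eq_norm_sq]
    exact (sq_eq_sq₀ (norm_nonneg _) (norm_nonneg _)).1 this

/-- Schröder–Bernstein inside a weak*-closed TRO `N`: if `u` and `v*` are in `N` and
`u : H → K`, `v : K → H` are isometries, then `N` contains a unitary. -/
theorem exists_unitary_mem {N : Submodule ℂ (H →L[ℂ] K)} (hN : IsWeakStarClosed N) (hTRO : IsTRO N)
    (u : H →L[ℂ] K) (v : K →L[ℂ] H) (hu : u ∈ N) (hv : adjoint v ∈ N)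
    (huu : ∀ x, adjoint u (u x) = x) (hvv : ∀ y, adjoint v (v y) = y) :
    ∃ U : H ≃ₗᵢ[ℂ] K, (U : H →L[ℂ] K) ∈ N := by
  have hN2 : ∀ A ∈ N, A ∘L v ∘L u ∈ N := fun A hA => by
    simpa using hTRO A hA _ hv _ hu
  have hN3 : ∀ A ∈ N, A ∘L adjoint u ∘L adjoint v ∈ N := fun A hA => hTRO A hA _ hu _ hv
  have hN4 : ∀ A ∈ N, A ∘L v ∘L adjoint v ∈ N := fun A hA => by
    simpa using hTRO A hA _ hv _ hv
  -- As in the set-theoretic proof, `p` projects onto the complement of the range of `v`, and the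
  -- subspaces `s^k (p H)` are the successive images of that complement under the isometry `s = v
  -- u`. Here `r = s*`.
  let s : H →L[ℂ] H := v ∘L u
  let r : H →L[ℂ] H := adjoint u ∘L adjoint v
  let p : H →L[ℂ] H := ContinuousLinearMap.id ℂ H - v ∘L adjoint v
  have hr : adjoint s = r := adjoint_comp _ _
  have hpadj : adjoint p = p := by
    simp only [p, map_sub, adjoint_comp, adjoint_adjoint, adjoint_id]
  have hpp : ∀ x, p (p x) = p x := fun x => by simp [p, hvv]
  have hps : ∀ x, p (s x) = 0 := fun x => by simp [p, s, hvv]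
  have hrp : ∀ x, r (p x) = 0 := fun x => by simp [p, r, hvv]
  have hrs : ∀ x, r (s x) = x := fun x => by simp [r, s, hvv, huu]
  have hunorm : ∀ y, ‖adjoint u y‖ ≤ ‖y‖ := fun y => by
    have h5 : ‖adjoint u‖ ≤ 1 := by
      rw [LinearIsometryEquiv.norm_map]
      refine opNorm_le_bound _ zero_le_one fun x => ?_
      rw [one_mul]
      refine le_of_sq_le_sq (le_of_eq ?_) (norm_nonneg _)
      rw [← inner_self_eq_norm_sq (𝕜 := ℂ), ← adjoint_inner_right, huu, inner_self_eq_norm_sq]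
    simpa using (adjoint u).le_of_opNorm_le h5 y
  have hpnorm : ∀ x, ‖p x‖ ^ 2 ≤ ‖x‖ ^ 2 - ‖r x‖ ^ 2 := fun x => by
    have h1 : ‖p x‖ ^ 2 = ‖x‖ ^ 2 - ‖adjoint v x‖ ^ 2 := by
      rw [← inner_self_eq_norm_sq (𝕜 := ℂ), ← adjoint_inner_right, hpadj, hpp]
      simp only [p, sub_apply, comp_apply, id_apply, inner_sub_right, map_sub,
        inner_self_eq_norm_sq]
      rw [← adjoint_inner_left, inner_self_eq_norm_sq]
    have h2 : ‖r x‖ ≤ ‖adjoint v x‖ := hunorm _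
    rw [h1]
    gcongr
  -- Chosen so that `P = T* T` below is `∑ s^k p r^k`, the projection onto the sum of the `s^k (p
  -- H)`. The bound on the column telescopes from `‖p x‖² ≤ ‖x‖² - ‖r x‖²`.
  let t : ℕ → H →L[ℂ] H := fun k => p ∘L (r ^ k)
  have ht : ∀ (n : ℕ) x, ∑ k ∈ Finset.range n, ‖t k x‖ ^ 2 ≤ ‖x‖ ^ 2 - ‖(r ^ n) x‖ ^ 2 := by
    intro n x
    induction n with
    | zero => simp
    | succ n ih =>
      rw [Finset.sum_range_succ]
      have h1 := hpnorm ((r ^ n) x)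
      have h2 : (r ^ (n + 1)) x = r ((r ^ n) x) := by rw [pow_succ']; rfl
      rw [h2]
      have h3 : t n x = p ((r ^ n) x) := rfl
      rw [h3]
      linarith
  obtain ⟨T, hT, hT1⟩ := exists_column t fun F ξ => by
    obtain ⟨n, hn⟩ := F.exists_nat_subset_range
    have h1 := Finset.sum_le_sum_of_subset_of_nonneg hn
      (f := fun k => ‖t k ξ‖ ^ 2) fun _ _ _ => by positivity
    have h2 := ht n ξ
    nlinarith [sq_nonneg ‖(r ^ n) ξ‖]
  let P : H →L[ℂ] H := adjoint T ∘L T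
  have hPsum : ∀ η ξ, HasSum (fun k => ⟪t k η, t k ξ⟫_ℂ) ⟪η, P ξ⟫_ℂ := hasSum_inner_column hT
  have hPadj : ∀ x y, ⟪P x, y⟫_ℂ = ⟪x, P y⟫_ℂ := fun x y => by
    simp [P, adjoint_inner_left, adjoint_inner_right]
  -- Splitting off the term `k = 0` of the series; the rest is the same series conjugated by `s`.
  have hPeq : ∀ x, P x = p x + s (P (r x)) := fun x => by
    refine ext_inner_left ℂ fun η => (hPsum η x).unique ?_
    have h1 := hPsum (r η) (r x)
    have h2 : ∀ k y, t k (r y) = t (k + 1) y := fun k y => by simp only [t, pow_succ]; rfl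
    simp only [h2] at h1
    have h3 := (hasSum_nat_add_iff (f := fun k => ⟪t k η, t k x⟫_ℂ) 1).1 h1
    suffices h5 : ⟪η, p x + s (P (r x))⟫_ℂ =
        ⟪r η, P (r x)⟫_ℂ + ∑ i ∈ Finset.range 1, ⟪t i η, t i x⟫_ℂ by rw [h5]; exact h3
    rw [inner_add_right, ← adjoint_inner_left s, hr, add_comm]
    congr 1
    have h4 : ∀ y, t 0 y = p y := fun y => by simp [t]
    simp only [Finset.sum_range_one, h4]
    rw [← adjoint_inner_right, hpadj, hpp]
  have hPp : ∀ x, P (p x) = p x := fun x => by rw [hPeq, hpp, hrp]; simp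
  have hPs : ∀ x, P (s x) = s (P x) := fun x => by rw [hPeq, hps, hrs]; simp
  have hpP : ∀ x, p (P x) = p x := fun x => by
    refine ext_inner_left ℂ fun η => ?_
    rw [← adjoint_inner_left, hpadj, ← hPadj, hPp, ← hpadj, adjoint_inner_left, hpadj]
  have hrP : ∀ x, r (P x) = P (r x) := fun x => by
    refine ext_inner_left ℂ fun η => ?_
    rw [← hr, adjoint_inner_right, ← hPadj, hPs, ← hPadj, adjoint_inner_right]
  have hPP : ∀ x, P (P x) = P x := fun x => by
    refine ext_inner_left ℂ fun η => ?_
    rw [← hPadj]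
    refine (hPsum (P η) x).unique ?_
    have h1 : ∀ k, t k (P η) = t k η := fun k => by
      have h2 : ∀ y, (r ^ k) (P y) = P ((r ^ k) y) := by
        intro y
        induction k with
        | zero => simp
        | succ k ih =>
          rw [pow_succ']
          change r ((r ^ k) (P y)) = P (r ((r ^ k) y))
          rw [ih, hrP]
      change p ((r ^ k) (P η)) = p ((r ^ k) η)
      rw [h2, hpP]
    simp only [h1]
    exact hPsum η x
  -- Right multiplication by `s`, `r` and `v v*` preserves `N` by the TRO property, hence so does
  -- each term of the series, and `comp_column_mem` passes to the sum.
  have hNp : ∀ A ∈ N, A ∘L P ∈ N := fun A hA => by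
    have h1 : ∀ k, ∀ A ∈ N, A ∘L (s ^ k) ∈ N := fun k => by
      induction k with
      | zero => intro A hA; exact hA
      | succ k ih =>
        intro A hA
        rw [pow_succ']
        exact ih _ (hN2 A hA)
    have h2 : ∀ k, ∀ A ∈ N, A ∘L (r ^ k) ∈ N := fun k => by
      induction k with
      | zero => intro A hA; exact hA
      | succ k ih =>
        intro A hA
        rw [pow_succ']
        exact ih _ (hN3 A hA)
    have h3 : ∀ A ∈ N, A ∘L p ∈ N := fun A hA => by
      have := N.sub_mem hA (hN4 A hA)
      simpa [p, comp_sub] using this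
    refine comp_column_mem hT hT1 hN A (ContinuousLinearMap.id ℂ H) fun k => ?_
    have h4 : adjoint (t k) = (s ^ k) ∘L p := by
      rw [adjoint_comp, hpadj]
      congr 1
      rw [← hr, ← star_eq_adjoint, ← star_eq_adjoint, star_pow, star_star]
    rw [h4]
    exact h2 k _ (h3 _ (h3 _ (h1 k A hA)))
  -- Use `u` on the range of `P` and `v*` on its complement, which lies in the range of `v` since `p
  -- ≤ P`.
  let U : H →L[ℂ] K := u ∘L P + (adjoint v - adjoint v ∘L P)
  have hUN : U ∈ N := N.add_mem (hNp u hu) (N.sub_mem hv (hNp _ hv))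
  have hUadj : ∀ y, adjoint U y = P (adjoint u y) + (v y - P (v y)) := fun y => by
    refine ext_inner_left ℂ fun η => ?_
    rw [adjoint_inner_right]
    simp only [U, add_apply, sub_apply, comp_apply, inner_add_left, inner_sub_left,
      inner_add_right, inner_sub_right, adjoint_inner_left, ← hPadj]
    rw [adjoint_inner_right]
  have hvp : ∀ x, v (adjoint v x) = x - p x := fun x => by simp [p]
  refine ⟨unitaryOfAdjoint U (fun x => ?_) (fun y => ?_), hUN⟩
  · rw [hUadj]
    have e1 : adjoint u (U x) = P x + (r x - r (P x)) := by simp [U, r, huu]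
    have e2 : v (U x) = s (P x) + ((x - p x) - (P x - p (P x))) := by simp [U, s, hvp]
    rw [e1, e2]
    simp only [map_add, map_sub, hPs, hPP, hrP, hPp, hpP]
    abel
  · rw [hUadj]
    -- Since `p v = 0` and `r v = u*`, the recursion for `P` gives `v u P u* = P v`. Thus `u P u* =
    -- v* P v`, and the ranges of the two pieces of `U` are complementary.
    have e1 : v (u (P (adjoint u y))) = P (v y) := by
      rw [hPeq (v y)]
      simp [p, s, r, hvv]
    have e2 : P (v y) = s (P (adjoint u y)) := e1.symm
    have e3 : adjoint v (P (v y)) = u (P (adjoint u y)) := by rw [e2]; simp [s, hvv]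
    simp only [U, add_apply, sub_apply, comp_apply, map_add, map_sub, hPP, hvv, e3]
    abel

end SchroederBernstein

/-! ### Algebra of the operators `x ⊗ a` -/

section TensorOps

variable {H₁ H₂ H₃ L₁ L₂ L₃ : Type*}
  [NormedAddCommGroup H₁] [InnerProductSpace ℂ H₁] [NormedAddCommGroup H₂] [InnerProductSpace ℂ H₂]
  [NormedAddCommGroup H₃] [InnerProductSpace ℂ H₃]
  [NormedAddCommGroup L₁] [InnerProductSpace ℂ L₁] [NormedAddCommGroup L₂] [InnerProductSpace ℂ L₂]
  [NormedAddCommGroup L₃] [InnerProductSpace ℂ L₃]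

theorem hilbertTensor_induction {P : HilbertTensor H₁ L₁ → Prop} (hP : IsClosed {x | P x})
    (h0 : P 0) (hadd : ∀ x y, P x → P y → P (x + y))
    (htmul : ∀ (h : H₁) (l : L₁), P ((h ⊗ₜ[ℂ] l : H₁ ⊗[ℂ] L₁) : HilbertTensor H₁ L₁))
    (x : HilbertTensor H₁ L₁) : P x := by
  induction x using UniformSpace.Completion.induction_on with
  | hp => exact hP
  | ih a =>
    induction a using TensorProduct.induction_on with
    | zero => exact (UniformSpace.Completion.coe_zero (α := H₁ ⊗[ℂ] L₁)).symm ▸ h0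
    | tmul h l => exact htmul h l
    | add a b ha hb => exact (UniformSpace.Completion.coe_add a b).symm ▸ hadd _ _ ha hb

theorem hilbertTensor_ext {E : Type*} [NormedAddCommGroup E] [NormedSpace ℂ E]
    {S T : HilbertTensor H₁ L₁ →L[ℂ] E}
    (h : ∀ (h : H₁) (l : L₁), S ((h ⊗ₜ[ℂ] l : H₁ ⊗[ℂ] L₁) : HilbertTensor H₁ L₁) =
      T ((h ⊗ₜ[ℂ] l : H₁ ⊗[ℂ] L₁) : HilbertTensor H₁ L₁)) : S = T := by
  ext x
  induction x using hilbertTensor_induction with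
  | hP => exact isClosed_eq S.continuous T.continuous
  | h0 => simp
  | hadd x y hx hy => simp [hx, hy]
  | htmul a l => exact h a l

theorem inner_coe_tmul (h h' : H₁) (l l' : L₁) :
    ⟪((h ⊗ₜ[ℂ] l : H₁ ⊗[ℂ] L₁) : HilbertTensor H₁ L₁),
      ((h' ⊗ₜ[ℂ] l' : H₁ ⊗[ℂ] L₁) : HilbertTensor H₁ L₁)⟫_ℂ = ⟪h, h'⟫_ℂ * ⟪l, l'⟫_ℂ := by
  rw [UniformSpace.Completion.inner_coe, TensorProduct.inner_tmul]

theorem tensorOp_comp (x : H₁ →L[ℂ] H₂) (a : L₁ →L[ℂ] L₂) (y : H₂ →L[ℂ] H₃) (b : L₂ →L[ℂ] L₃) :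
    tensorOp y b ∘L tensorOp x a = tensorOp (y ∘L x) (b ∘L a) :=
  hilbertTensor_ext fun h l => by
    simp only [comp_apply, tensorOp_tmul]

theorem adjoint_tensorOp [CompleteSpace H₁] [CompleteSpace H₂] [CompleteSpace L₁]
    [CompleteSpace L₂] (x : H₁ →L[ℂ] H₂) (a : L₁ →L[ℂ] L₂) :
    adjoint (tensorOp x a) = tensorOp (adjoint x) (adjoint a) := by
  refine hilbertTensor_ext fun h l => ext_inner_right ℂ fun z => ?_
  rw [adjoint_inner_left]
  induction z using hilbertTensor_induction with
  | hP => exact isClosed_eq (by fun_prop) (by fun_prop)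
  | h0 => simp
  | hadd x y hx hy => simp only [map_add, inner_add_right, hx, hy]
  | htmul h' l' =>
    simp only [tensorOp_tmul, inner_coe_tmul, adjoint_inner_left]

end TensorOps

/-! ### Matrix entries of operators on `H ⊗ ℓ²_J` -/

section Coordinates

variable {H K J : Type*}
  [NormedAddCommGroup H] [InnerProductSpace ℂ H] [CompleteSpace H]
  [NormedAddCommGroup K] [InnerProductSpace ℂ K] [CompleteSpace K]

open scoped Classical in
/-- The isometry `ξ ↦ ξ ⊗ eᵢ` of `H` into `H ⊗ ℓ²_J`. -/
noncomputable def tensorSingle (H : Type*) [NormedAddCommGroup H] [InnerProductSpace ℂ H]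
    {J : Type*} (i : J) : H →ₗᵢ[ℂ] HilbertTensor H (ellTwo J) where
  toFun ξ := ((ξ ⊗ₜ[ℂ] lp.single 2 i (1 : ℂ) : H ⊗[ℂ] ellTwo J) : HilbertTensor H (ellTwo J))
  map_add' a b := by
    rw [TensorProduct.add_tmul]
    exact UniformSpace.Completion.coe_add _ _
  map_smul' c a := by
    rw [← TensorProduct.smul_tmul']
    exact UniformSpace.Completion.coe_smul _ _
  norm_map' a := by simp [UniformSpace.Completion.norm_coe, lp.norm_single]

open scoped Classical in
theorem tensorSingle_apply {H : Type*} [NormedAddCommGroup H] [InnerProductSpace ℂ H]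
    (i : J) (ξ : H) : tensorSingle H i ξ =
    ((ξ ⊗ₜ[ℂ] lp.single 2 i (1 : ℂ) : H ⊗[ℂ] ellTwo J) : HilbertTensor H (ellTwo J)) := rfl

omit [CompleteSpace H] in
theorem orthogonalFamily_tensorSingle :
    OrthogonalFamily ℂ (fun _ : J => H) (tensorSingle H) := by
  classical
  intro i j hij v w
  rw [tensorSingle_apply, tensorSingle_apply, inner_coe_tmul]
  simp [lp.inner_single_left, hij]

/-- Elementary tensors span a dense subspace, and `ξ ⊗ l = ∑ l i • (ξ ⊗ eᵢ)` because `ξ ⊗ ·` is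
continuous. -/
theorem isHilbertSum_tensorSingle :
    IsHilbertSum ℂ (fun _ : J => H) (tensorSingle H) := by
  classical
  refine IsHilbertSum.mk orthogonalFamily_tensorSingle fun x hx => ?_
  clear hx
  set W := (⨆ i : J, (tensorSingle H i).range).topologicalClosure with hW
  have hWc : IsClosed (W : Set (HilbertTensor H (ellTwo J))) :=
    Submodule.isClosed_topologicalClosure _
  have hmem : ∀ i ξ, tensorSingle H i ξ ∈ W := fun i ξ =>
    Submodule.le_topologicalClosure _
      (Submodule.mem_iSup_of_mem i (LinearMap.mem_range_self _ ξ))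
  induction x using hilbertTensor_induction with
  | hP => exact hWc
  | h0 => exact W.zero_mem
  | hadd x y hx hy => exact W.add_mem hx hy
  | htmul ξ l =>
    have h1 := lp.hasSum_single (p := 2) (by norm_num) l
    let f : ellTwo J →L[ℂ] HilbertTensor H (ellTwo J) :=
      UniformSpace.Completion.toComplL ∘L TensorProduct.mkL ℂ H (ellTwo J) ξ
    refine hWc.mem_of_tendsto (f.hasSum h1) (Eventually.of_forall fun F => ?_)
    refine W.sum_mem fun i _ => ?_
    have : f (lp.single 2 i (l i)) = (l i) • tensorSingle H i ξ := by
      rw [tensorSingle_apply]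
      have h2 : lp.single 2 i (l i) = l i • (lp.single 2 i (1 : ℂ) : ellTwo J) := by
        rw [← lp.single_smul]; simp
      rw [h2, map_smul]
      rfl
    exact this ▸ W.smul_mem _ (hmem i ξ)

open scoped Classical in
theorem adjoint_tensorSingle_tensorSingle (i j : J) (ξ : H) :
    adjoint (tensorSingle H i).toContinuousLinearMap (tensorSingle H j ξ) =
      if j = i then ξ else 0 := by
  refine ext_inner_left ℂ fun η => ?_
  rw [adjoint_inner_right]
  split_ifs with h
  · subst h
    exact (tensorSingle H j).inner_map_map η ξ
  · rw [inner_zero_right]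
    exact orthogonalFamily_tensorSingle (Ne.symm h) η ξ

theorem adjoint_tensorSingle_tmul (i : J) (ξ : H) (l : ellTwo J) :
    adjoint (tensorSingle H i).toContinuousLinearMap
      ((ξ ⊗ₜ[ℂ] l : H ⊗[ℂ] ellTwo J) : HilbertTensor H (ellTwo J)) = l i • ξ := by
  classical
  refine ext_inner_left ℂ fun η => ?_
  rw [adjoint_inner_right]
  change ⟪tensorSingle H i η, _⟫_ℂ = _
  rw [tensorSingle_apply, inner_coe_tmul, lp.inner_single_left, inner_smul_right]
  simp [mul_comm]

theorem hasSum_tensorSingle (x : HilbertTensor H (ellTwo J)) :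
    HasSum (fun i => tensorSingle H i (adjoint (tensorSingle H i).toContinuousLinearMap x)) x := by
  classical
  have h := isHilbertSum_tensorSingle.hasSum_linearIsometryEquiv_symm
    ((isHilbertSum_tensorSingle (H := H) (J := J)).linearIsometryEquiv x)
  rw [LinearIsometryEquiv.symm_apply_apply] at h
  have h2 : ∀ i, adjoint (tensorSingle H i).toContinuousLinearMap x =
      (isHilbertSum_tensorSingle (H := H) (J := J)).linearIsometryEquiv x i := fun i => by
    refine ((adjoint (tensorSingle H i).toContinuousLinearMap).hasSum h).unique ?_
    simp only [adjoint_tensorSingle_tensorSingle]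
    convert hasSum_ite_eq i _ using 2
    · split_ifs with hh
      · subst hh; rfl
      · rfl
  simpa only [h2] using h

/-- The projection of `H ⊗ ℓ²_J` onto the coordinates in the finite set `F`. -/
noncomputable def tensorTrunc (H : Type*) [NormedAddCommGroup H] [InnerProductSpace ℂ H]
    [CompleteSpace H] {J : Type*} (F : Finset J) :
    HilbertTensor H (ellTwo J) →L[ℂ] HilbertTensor H (ellTwo J) :=
  ∑ i ∈ F, (tensorSingle H i).toContinuousLinearMap ∘L
    adjoint (tensorSingle H i).toContinuousLinearMap

theorem tensorTrunc_apply (F : Finset J) (x : HilbertTensor H (ellTwo J)) :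
    tensorTrunc H F x =
      ∑ i ∈ F, tensorSingle H i (adjoint (tensorSingle H i).toContinuousLinearMap x) := by
  simp [tensorTrunc, sum_apply]

theorem tendsto_tensorTrunc (x : HilbertTensor H (ellTwo J)) :
    Tendsto (fun F : Finset J => tensorTrunc H F x) atTop (𝓝 x) := by
  simp only [tensorTrunc_apply]
  exact hasSum_tensorSingle x

theorem adjoint_tensorTrunc (F : Finset J) : adjoint (tensorTrunc H F) = tensorTrunc H F := by
  simp [tensorTrunc, map_sum, adjoint_comp]

theorem tensorTrunc_tensorTrunc (F : Finset J) (x : HilbertTensor H (ellTwo J)) :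
    tensorTrunc H F (tensorTrunc H F x) = tensorTrunc H F x := by
  classical
  simp only [tensorTrunc_apply, map_sum, adjoint_tensorSingle_tensorSingle]
  refine Finset.sum_congr rfl fun i hi => ?_
  simp [apply_ite, hi]

theorem norm_tensorTrunc_le (F : Finset J) : ‖tensorTrunc H F‖ ≤ 1 := by
  refine opNorm_le_bound _ zero_le_one fun x => ?_
  have h1 : ‖tensorTrunc H F x‖ ^ 2 ≤ ‖x‖ * ‖tensorTrunc H F x‖ := by
    rw [← inner_self_eq_norm_sq (𝕜 := ℂ), ← adjoint_inner_right, adjoint_tensorTrunc,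
      tensorTrunc_tensorTrunc]
    exact (RCLike.re_le_norm _).trans (norm_inner_le_norm _ _)
  nlinarith [norm_nonneg x, norm_nonneg (tensorTrunc H F x)]

open scoped Classical in
/-- The matrix unit of `M_J` with entry `1` at position `(i, j)`. -/
noncomputable def matrixUnit {J : Type*} (i j : J) : MatrixSpace J :=
  (lp.evalCLM ℂ (fun _ : J => ℂ) 2 j).smulRight (lp.single 2 i (1 : ℂ))

omit [CompleteSpace K] in
theorem tensorOp_matrixUnit (x : H →L[ℂ] K) (i j : J) :
    tensorOp x (matrixUnit i j) = (tensorSingle K i).toContinuousLinearMap ∘L x ∘L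
      adjoint (tensorSingle H j).toContinuousLinearMap := by
  classical
  refine hilbertTensor_ext fun ξ l => ?_
  rw [tensorOp_tmul]
  simp only [comp_apply, adjoint_tensorSingle_tmul, map_smul]
  change _ = l j • tensorSingle K i (x ξ)
  rw [tensorSingle_apply]
  have : matrixUnit i j l = l j • (lp.single 2 i (1 : ℂ) : ellTwo J) := by
    simp [matrixUnit, lp.evalCLM]
  rw [this, TensorProduct.tmul_smul]
  exact UniformSpace.Completion.coe_smul _ _

/-- An operator whose matrix entries are in `N` is in the weak*-closed span of `N ⊗ M_J`. -/
theorem mem_stabilization_of_entries {N : Submodule ℂ (H →L[ℂ] K)}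
    {T : HilbertTensor H (ellTwo J) →L[ℂ] HilbertTensor K (ellTwo J)}
    (h : ∀ i j, adjoint (tensorSingle K i).toContinuousLinearMap ∘L T ∘L
      (tensorSingle H j).toContinuousLinearMap ∈ N) : T ∈ stabilization N J := by
  refine (isWeakStarClosed_weakStarSpan _).mem_of_tendsto_inner
    (l := (atTop : Filter (Finset J)))
    (T := fun F => tensorTrunc K F ∘L T ∘L tensorTrunc H F) (1 * (‖T‖ * 1))
    (fun F => ?_) (fun F => ?_) fun ξ η => ?_
  · refine (opNorm_comp_le _ _).trans (mul_le_mul (norm_tensorTrunc_le F) ?_ (norm_nonneg _)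
      zero_le_one)
    exact (opNorm_comp_le _ _).trans
      (mul_le_mul_of_nonneg_left (norm_tensorTrunc_le F) (norm_nonneg _))
  -- A finite truncation is the finite sum of its entries tensored with matrix units. The
  -- truncations are bounded by `‖T‖` and converge to `T` weakly.
  · have : tensorTrunc K F ∘L T ∘L tensorTrunc H F = ∑ i ∈ F, ∑ j ∈ F,
        tensorOp (adjoint (tensorSingle K i).toContinuousLinearMap ∘L T ∘L
          (tensorSingle H j).toContinuousLinearMap) (matrixUnit i j) := by
      ext x
      simp only [comp_apply, tensorTrunc_apply, sum_apply, map_sum, tensorOp_matrixUnit]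
      exact Finset.sum_comm' (by simp)
    rw [this]
    exact Submodule.sum_mem _ fun i _ => Submodule.sum_mem _ fun j _ =>
      subset_weakStarSpan _ ⟨_, h i j, _, rfl⟩
  · have h1 : Tendsto (fun F : Finset J => ⟪tensorTrunc K F η, T (tensorTrunc H F ξ)⟫_ℂ) atTop
        (𝓝 ⟪η, T ξ⟫_ℂ) :=
      (tendsto_tensorTrunc η).inner ((T.continuous.tendsto _).comp (tendsto_tensorTrunc ξ))
    refine h1.congr fun F => ?_
    simp only [comp_apply]
    rw [← adjoint_inner_left (tensorTrunc K F), adjoint_tensorTrunc]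

/-- A family `t` with `∑ t* t = 1` spreads out to an isometry of `H ⊗ ℓ²_J` into `K ⊗ ℓ²_J` whose
matrix entries are `0` or members of the family. -/
theorem exists_isometry_entries (π : J × J ≃ J) {N : Submodule ℂ (H →L[ℂ] K)}
    (t : J → H →L[ℂ] K) (ht : ∀ j, t j ∈ N)
    (hsum : ∀ ξ, HasSum (fun j => ‖t j ξ‖ ^ 2) (‖ξ‖ ^ 2)) :
    ∃ u : HilbertTensor H (ellTwo J) →L[ℂ] HilbertTensor K (ellTwo J),
      (∀ x, adjoint u (u x) = x) ∧
      ∀ i j, adjoint (tensorSingle K i).toContinuousLinearMap ∘L u ∘L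
        (tensorSingle H j).toContinuousLinearMap ∈ N := by
  classical
  obtain ⟨T, hT, -⟩ := exists_column t fun F ξ =>
    sum_le_hasSum F (fun j _ => by positivity) (hsum ξ)
  have hTn : ∀ ξ, ‖T ξ‖ = ‖ξ‖ := fun ξ => by
    have h1 := hasSum_norm_sq (T ξ)
    simp only [hT] at h1
    exact (sq_eq_sq₀ (norm_nonneg _) (norm_nonneg _)).1 (h1.unique (hsum ξ))
  let W : H →ₗᵢ[ℂ] lp (fun _ : J => K) 2 := ⟨T.toLinearMap, hTn⟩
  have hE : ∀ i, OrthogonalFamily ℂ (fun _ : J => K) fun j => tensorSingle K (π (i, j)) :=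
    fun i => orthogonalFamily_tensorSingle.comp
      (γ := J) (f := fun j => π (i, j)) fun a b hab => by simpa using hab
  -- `V i` is the column `t` placed in the coordinates `π (i, j)`, `j ∈ J`. For different `i` these
  -- blocks are disjoint, so the ranges are orthogonal and `ξ ⊗ eᵢ ↦ V i ξ` extends to an isometry.
  let V : J → H →ₗᵢ[ℂ] HilbertTensor K (ellTwo J) := fun i => (hE i).linearIsometry.comp W
  have hVsum : ∀ i ξ, HasSum (fun j => tensorSingle K (π (i, j)) (t j ξ)) (V i ξ) := fun i ξ => by
    have := (hE i).hasSum_linearIsometry (W ξ)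
    have h2 : ∀ j, W ξ j = t j ξ := hT ξ
    simp only [h2] at this
    exact this
  have hVentry : ∀ k i ξ, adjoint (tensorSingle K k).toContinuousLinearMap (V i ξ) =
      if (π.symm k).1 = i then t (π.symm k).2 ξ else 0 := fun k i ξ => by
    have h1 := (adjoint (tensorSingle K k).toContinuousLinearMap).hasSum (hVsum i ξ)
    simp only [adjoint_tensorSingle_tensorSingle] at h1
    refine h1.unique ?_
    obtain ⟨⟨a, b⟩, rfl⟩ := π.surjective k
    simp only [EmbeddingLike.apply_eq_iff_eq, Prod.mk.injEq, Equiv.symm_apply_apply]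
    by_cases hai : a = i
    · subst hai
      have h2 : (fun c => if c = b then t c ξ else 0) = fun c => if c = b then t b ξ else 0 := by
        ext c
        split_ifs with hc
        · rw [hc]
        · rfl
      simpa [h2] using hasSum_ite_eq b (t b ξ)
    · simp [hai, Ne.symm hai, hasSum_zero]
  have hV : OrthogonalFamily ℂ (fun _ : J => H) V := by
    intro i j hij ξ ζ
    refine (((innerSL ℂ (V i ξ)).hasSum (hVsum j ζ)).unique ?_)
    convert hasSum_zero with k
    change ⟪V i ξ, (tensorSingle K (π (j, k))).toContinuousLinearMap (t k ζ)⟫_ℂ = 0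
    rw [← adjoint_inner_left, hVentry]
    simp [Ne.symm hij]
  let e := (isHilbertSum_tensorSingle (H := H) (J := J)).linearIsometryEquiv
  let u : HilbertTensor H (ellTwo J) →ₗᵢ[ℂ] HilbertTensor K (ellTwo J) :=
    hV.linearIsometry.comp e.toLinearIsometry
  refine ⟨u.toContinuousLinearMap, fun x => ?_, fun i j => ?_⟩
  · refine ext_inner_left ℂ fun y => ?_
    rw [adjoint_inner_right]
    exact u.inner_map_map y x
  · have h1 : ∀ ξ, u (tensorSingle H j ξ) = V j ξ := fun ξ => by
      have h2 : e (tensorSingle H j ξ) = lp.single 2 j ξ :=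
        (e.symm_apply_eq.1 (isHilbertSum_tensorSingle.linearIsometryEquiv_symm_apply_single ξ)).symm
      change hV.linearIsometry (e (tensorSingle H j ξ)) = _
      rw [h2, hV.linearIsometry_apply_single]
    have h3 : adjoint (tensorSingle K i).toContinuousLinearMap ∘L u.toContinuousLinearMap ∘L
        (tensorSingle H j).toContinuousLinearMap =
        if (π.symm i).1 = j then t (π.symm i).2 else 0 := by
      ext ξ
      change adjoint (tensorSingle K i).toContinuousLinearMap (u (tensorSingle H j ξ)) = _
      rw [h1, hVentry]
      split_ifs <;> rfl
    rw [h3]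
    split_ifs
    · exact ht _
    · exact N.zero_mem

end Coordinates

/-! ### Weak*-closed TROs, their stabilizations, and nondegeneracy -/

section TROTools

variable {H K H₁ H₂ K₁ K₂ : Type*}
  [NormedAddCommGroup H] [InnerProductSpace ℂ H] [CompleteSpace H]
  [NormedAddCommGroup K] [InnerProductSpace ℂ K] [CompleteSpace K]
  [NormedAddCommGroup H₁] [InnerProductSpace ℂ H₁] [CompleteSpace H₁]
  [NormedAddCommGroup H₂] [InnerProductSpace ℂ H₂] [CompleteSpace H₂]
  [NormedAddCommGroup K₁] [InnerProductSpace ℂ K₁] [CompleteSpace K₁]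
  [NormedAddCommGroup K₂] [InnerProductSpace ℂ K₂] [CompleteSpace K₂]

theorem comp_comp_adjoint_mem {S₂ : Set (H₂ →L[ℂ] K₂)} {S : Set (H₁ →L[ℂ] H₂)}
    {S₁ : Set (H₁ →L[ℂ] K₁)} {Z : Submodule ℂ (K₁ →L[ℂ] K₂)} (hZ : IsWeakStarClosed Z)
    (h : ∀ b ∈ S₂, ∀ x ∈ S, ∀ a ∈ S₁, b ∘L x ∘L adjoint a ∈ Z)
    {b : H₂ →L[ℂ] K₂} (hb : b ∈ weakStarSpan S₂) {x : H₁ →L[ℂ] H₂} (hx : x ∈ weakStarSpan S)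
    {a : H₁ →L[ℂ] K₁} (ha : a ∈ weakStarSpan S₁) : b ∘L x ∘L adjoint a ∈ Z := by
  have h1 : ∀ b ∈ weakStarSpan S₂, ∀ x ∈ S, ∀ a ∈ S₁, b ∘L x ∘L adjoint a ∈ Z :=
    fun b hb x hx a ha => comp_mem_of_mem_weakStarSpan hZ (ContinuousLinearMap.id ℂ K₂)
      (x ∘L adjoint a) (fun s hs => h s hs x hx a ha) hb
  have h2 : ∀ b ∈ weakStarSpan S₂, ∀ x ∈ weakStarSpan S, ∀ a ∈ S₁, b ∘L x ∘L adjoint a ∈ Z :=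
    fun b hb x hx a ha => comp_mem_of_mem_weakStarSpan hZ b (adjoint a)
      (fun s hs => h1 b hb s hs a ha) hx
  exact comp_adjoint_mem_of_mem_weakStarSpan hZ (b ∘L x) (ContinuousLinearMap.id ℂ K₁)
    (fun s hs => h2 b hb x hx s hs) ha

omit [CompleteSpace H₁] in
theorem adjoint_comp_comp_mem {S₂ : Set (H₂ →L[ℂ] K₂)} {S : Set (K₁ →L[ℂ] K₂)}
    {S₁ : Set (H₁ →L[ℂ] K₁)} {Z : Submodule ℂ (H₁ →L[ℂ] H₂)} (hZ : IsWeakStarClosed Z)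
    (h : ∀ b ∈ S₂, ∀ y ∈ S, ∀ a ∈ S₁, adjoint b ∘L y ∘L a ∈ Z)
    {b : H₂ →L[ℂ] K₂} (hb : b ∈ weakStarSpan S₂) {y : K₁ →L[ℂ] K₂} (hy : y ∈ weakStarSpan S)
    {a : H₁ →L[ℂ] K₁} (ha : a ∈ weakStarSpan S₁) : adjoint b ∘L y ∘L a ∈ Z := by
  have h1 : ∀ b ∈ weakStarSpan S₂, ∀ y ∈ S, ∀ a ∈ S₁, adjoint b ∘L y ∘L a ∈ Z :=
    fun b hb y hy a ha => comp_adjoint_mem_of_mem_weakStarSpan hZ (ContinuousLinearMap.id ℂ H₂)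
      (y ∘L a) (fun s hs => h s hs y hy a ha) hb
  have h2 : ∀ b ∈ weakStarSpan S₂, ∀ y ∈ weakStarSpan S, ∀ a ∈ S₁, adjoint b ∘L y ∘L a ∈ Z :=
    fun b hb y hy a ha => comp_mem_of_mem_weakStarSpan hZ (adjoint b) a
      (fun s hs => h1 b hb s hs a ha) hy
  exact comp_mem_of_mem_weakStarSpan hZ (adjoint b ∘L y) (ContinuousLinearMap.id ℂ H₁)
    (fun s hs => h2 b hb y hy s hs) ha

theorem isTRO_weakStarSpan {S : Set (H →L[ℂ] K)}
    (h : ∀ a ∈ S, ∀ b ∈ S, ∀ c ∈ S, a ∘L adjoint b ∘L c ∈ weakStarSpan S) :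
    IsTRO (weakStarSpan S) := by
  have hZ := isWeakStarClosed_weakStarSpan S
  have h1 : ∀ a ∈ weakStarSpan S, ∀ b ∈ S, ∀ c ∈ S, a ∘L adjoint b ∘L c ∈ weakStarSpan S :=
    fun a ha b hb c hc => comp_mem_of_mem_weakStarSpan hZ (ContinuousLinearMap.id ℂ K)
      (adjoint b ∘L c) (fun s hs => h s hs b hb c hc) ha
  have h2 : ∀ a ∈ weakStarSpan S, ∀ b ∈ weakStarSpan S, ∀ c ∈ S,
      a ∘L adjoint b ∘L c ∈ weakStarSpan S :=
    fun a ha b hb c hc => comp_adjoint_mem_of_mem_weakStarSpan hZ a c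
      (fun s hs => h1 a ha s hs c hc) hb
  exact fun a ha b hb c hc => comp_mem_of_mem_weakStarSpan hZ (a ∘L adjoint b)
    (ContinuousLinearMap.id ℂ H) (fun s hs => h2 a ha b hb s hs) hc

theorem IsTRO.weakStarSpan {M : Submodule ℂ (H →L[ℂ] K)} (hM : IsTRO M) :
    IsTRO (weakStarSpan (M : Set (H →L[ℂ] K))) :=
  isTRO_weakStarSpan fun a ha b hb c hc => subset_weakStarSpan _ (hM a ha b hb c hc)

omit [CompleteSpace H] [CompleteSpace K] in
theorem tensorOp_mem_stabilization {N : Submodule ℂ (H →L[ℂ] K)} {x : H →L[ℂ] K} (hx : x ∈ N)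
    {J : Type*} (a : MatrixSpace J) : tensorOp x a ∈ stabilization N J :=
  subset_weakStarSpan _ ⟨x, hx, a, rfl⟩

theorem IsTRO.stabilization {N : Submodule ℂ (H →L[ℂ] K)} (hN : IsTRO N) (J : Type*) :
    IsTRO (stabilization N J) := by
  refine isTRO_weakStarSpan ?_
  rintro _ ⟨x, hx, a, rfl⟩ _ ⟨y, hy, b, rfl⟩ _ ⟨z, hz, c, rfl⟩
  rw [adjoint_tensorOp, tensorOp_comp, tensorOp_comp]
  exact tensorOp_mem_stabilization (hN x hx y hy z hz) _

/-- The subspace of the adjoints of the elements of `N`. -/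
noncomputable def adjointSubmodule (N : Submodule ℂ (H →L[ℂ] K)) : Submodule ℂ (K →L[ℂ] H) where
  carrier := {T | adjoint T ∈ N}
  zero_mem' := by simp
  add_mem' {a b} ha hb := by simpa using N.add_mem ha hb
  smul_mem' c a ha := by
    have := N.smul_mem (star c) ha
    simpa [map_smulₛₗ] using this

theorem mem_adjointSubmodule {N : Submodule ℂ (H →L[ℂ] K)} {T : K →L[ℂ] H} :
    T ∈ adjointSubmodule N ↔ adjoint T ∈ N := Iff.rfl

theorem IsWeakStarClosed.adjointSubmodule {N : Submodule ℂ (H →L[ℂ] K)}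
    (hN : IsWeakStarClosed N) : IsWeakStarClosed (adjointSubmodule N) := by
  let _ := weakStarTopology H K
  let _ := weakStarTopology K H
  exact IsClosed.preimage continuous_weakStar_adjoint hN

theorem IsTRO.adjointSubmodule {N : Submodule ℂ (H →L[ℂ] K)} (hN : IsTRO N) :
    IsTRO (adjointSubmodule N) := fun a ha b hb c hc => by
  rw [mem_adjointSubmodule] at *
  have := hN _ hc _ hb _ ha
  simpa [adjoint_comp, comp_assoc] using this

theorem exists_isometry_of_isTRO {N : Submodule ℂ (H →L[ℂ] K)} (hN : IsWeakStarClosed N)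
    (hTRO : IsTRO N) (hker : ∀ ξ : H, (∀ m ∈ N, m ξ = 0) → ξ = 0) {J : Type*} [Infinite J]
    (f : (H →L[ℂ] K) ↪ J) :
    ∃ u : HilbertTensor H (ellTwo J) →L[ℂ] HilbertTensor K (ellTwo J),
      (∀ x, adjoint u (u x) = x) ∧
      ∀ i j, adjoint (tensorSingle K i).toContinuousLinearMap ∘L u ∘L
        (tensorSingle H j).toContinuousLinearMap ∈ N := by
  classical
  obtain ⟨S, hSN, hS⟩ := exists_partition hN hTRO hker
  obtain ⟨π⟩ : Nonempty (J × J ≃ J) := by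
    rw [← Cardinal.eq, ← Cardinal.mul_def]
    exact Cardinal.mul_eq_self (Cardinal.aleph0_le_mk J)
  have hι : Function.Injective fun m : S => f m.1 := f.injective.comp Subtype.val_injective
  -- The partition is reindexed by `J` through `f` and padded with zero operators, which do not
  -- change the sum.
  refine exists_isometry_entries π (Function.extend (fun m : S => f m.1) Subtype.val 0)
    (fun j => ?_) fun ξ => ?_
  · by_cases hj : ∃ m : S, f m.1 = j
    · obtain ⟨m, rfl⟩ := hj
      rw [hι.extend_apply]
      exact hSN m.2
    · rw [Function.extend_apply' _ _ _ hj]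
      exact N.zero_mem
  · rw [← hι.hasSum_iff]
    · simpa only [Function.comp_def, hι.extend_apply] using hS ξ
    · intro j hj
      rw [Function.extend_apply' _ _ _ hj]
      simp

/-- If `N` is a nondegenerate weak*-closed TRO, then `N ⊗̄ M_J` contains a unitary once `J` is
large. -/
theorem exists_unitary_mem_stabilization {N : Submodule ℂ (H →L[ℂ] K)} (hN : IsWeakStarClosed N)
    (hTRO : IsTRO N) (hker : ∀ ξ : H, (∀ m ∈ N, m ξ = 0) → ξ = 0)
    (hker' : ∀ η : K, (∀ m ∈ N, adjoint m η = 0) → η = 0) {J : Type*} [Infinite J]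
    (f : (H →L[ℂ] K) ↪ J) (g : (K →L[ℂ] H) ↪ J) :
    ∃ U : HilbertTensor H (ellTwo J) ≃ₗᵢ[ℂ] HilbertTensor K (ellTwo J),
      (U : HilbertTensor H (ellTwo J) →L[ℂ] HilbertTensor K (ellTwo J)) ∈ stabilization N J := by
  obtain ⟨u, hu, huN⟩ := exists_isometry_of_isTRO hN hTRO hker f
  obtain ⟨v, hv, hvN⟩ := exists_isometry_of_isTRO hN.adjointSubmodule hTRO.adjointSubmodule
    (fun η h => hker' η fun m hm => h _ (by simpa [mem_adjointSubmodule] using hm)) g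
  refine exists_unitary_mem (isWeakStarClosed_weakStarSpan _) (hTRO.stabilization J) u v
    (mem_stabilization_of_entries huN) (mem_stabilization_of_entries fun i j => ?_) hu hv
  -- The `(i, j)` entry of `v*` is the adjoint of the `(j, i)` entry of `v`, which has entries in
  -- `N*`.
  have := hvN j i
  rw [mem_adjointSubmodule] at this
  simpa [adjoint_comp, comp_assoc] using this

omit [CompleteSpace H] [CompleteSpace K] in
-- `t ↦ ⟪η, t ξ⟫` is the normal functional of two sequences supported at index `0`, so its kernel is
-- weak*-closed.
theorem inner_eq_zero_of_mem_weakStarSpan {S : Set (H →L[ℂ] K)} {ξ : H} {η : K}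
    (h : ∀ s ∈ S, ⟪η, s ξ⟫_ℂ = 0) {t : H →L[ℂ] K} (ht : t ∈ weakStarSpan S) :
    ⟪η, t ξ⟫_ℂ = 0 := by
  have key : ∀ T : H →L[ℂ] K,
      normalFunctional (lp.single 2 0 ξ) (lp.single 2 0 η) T = ⟪η, T ξ⟫_ℂ := fun T => by
    change ∑' n, _ = _
    rw [tsum_eq_single 0]
    · simp
    · intro n hn
      simp [hn]
  have hc : IsWeakStarClosed (LinearMap.ker
      (normalFunctional (H := H) (K := K) (lp.single 2 0 ξ) (lp.single 2 0 η))) := by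
    let _ := weakStarTopology H K
    exact IsClosed.preimage (continuous_normalFunctional _ _) isClosed_singleton
  rw [← key]
  exact weakStarSpan_le hc (fun s hs => by
    rw [SetLike.mem_coe, LinearMap.mem_ker, key]; exact h s hs) ht

theorem ActsNondegenerately.eq_zero {X : Submodule ℂ (H →L[ℂ] K)} (hX : ActsNondegenerately X)
    {ξ : H} (h : ∀ x ∈ X, ∀ η, ⟪η, x ξ⟫_ℂ = 0) : ξ = 0 := by
  have h1 := (Submodule.topologicalClosure_eq_top_iff).1 hX.2
  rw [← Submodule.mem_bot ℂ, ← h1]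
  refine (Submodule.mem_orthogonal _ _).2 fun v hv => ?_
  induction hv using Submodule.span_induction with
  | mem v hv =>
    obtain ⟨x, hx, η, rfl⟩ := hv
    rw [adjoint_inner_left]
    exact h x hx η
  | zero => simp
  | add a b _ _ ha hb => rw [inner_add_left, ha, hb, add_zero]
  | smul c a _ ha => rw [inner_smul_left, ha, mul_zero]

theorem ActsNondegenerately.eq_zero' {X : Submodule ℂ (H →L[ℂ] K)} (hX : ActsNondegenerately X)
    {η : K} (h : ∀ x ∈ X, ∀ ξ, ⟪η, x ξ⟫_ℂ = 0) : η = 0 := by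
  have h1 := (Submodule.topologicalClosure_eq_top_iff).1 hX.1
  rw [← Submodule.mem_bot ℂ, ← h1]
  refine (Submodule.mem_orthogonal' _ _).2 fun v hv => ?_
  induction hv using Submodule.span_induction with
  | mem v hv =>
    obtain ⟨x, hx, ξ, rfl⟩ := hv
    exact h x hx ξ
  | zero => simp
  | add a b _ _ ha hb => rw [inner_add_right, ha, hb, add_zero]
  | smul c a _ ha => rw [inner_smul_right, ha, mul_zero]

end TROTools

/-! ### Conjugation by unitaries is a complete isometry and a weak*-homeomorphism -/

section Conj

variable {H₁ H₂ K₁ K₂ : Type*}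
  [NormedAddCommGroup H₁] [InnerProductSpace ℂ H₁] [CompleteSpace H₁]
  [NormedAddCommGroup H₂] [InnerProductSpace ℂ H₂] [CompleteSpace H₂]
  [NormedAddCommGroup K₁] [InnerProductSpace ℂ K₁] [CompleteSpace K₁]
  [NormedAddCommGroup K₂] [InnerProductSpace ℂ K₂] [CompleteSpace K₂]

omit [CompleteSpace H₂] [CompleteSpace K₂] in
theorem unitaryConj_apply (U₁ : H₁ ≃ₗᵢ[ℂ] K₁) (U₂ : H₂ ≃ₗᵢ[ℂ] K₂) (T : H₁ →L[ℂ] H₂) (ξ : K₁) :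
    unitaryConj U₁ U₂ T ξ = U₂ (T (U₁.symm ξ)) := by
  have : adjoint (U₁ : H₁ →L[ℂ] K₁) ξ = U₁.symm ξ := by
    rw [LinearIsometryEquiv.adjoint_eq_symm]; rfl
  change U₂ (T (adjoint (U₁ : H₁ →L[ℂ] K₁) ξ)) = _
  rw [this]

omit [CompleteSpace H₂] [CompleteSpace K₂] in
theorem unitaryConj_symm_unitaryConj (U₁ : H₁ ≃ₗᵢ[ℂ] K₁) (U₂ : H₂ ≃ₗᵢ[ℂ] K₂)
    (T : H₁ →L[ℂ] H₂) : unitaryConj U₁.symm U₂.symm (unitaryConj U₁ U₂ T) = T := by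
  ext ξ; simp [unitaryConj_apply]

omit [CompleteSpace H₂] [CompleteSpace K₂] in
theorem unitaryConj_unitaryConj_symm (U₁ : H₁ ≃ₗᵢ[ℂ] K₁) (U₂ : H₂ ≃ₗᵢ[ℂ] K₂)
    (T : K₁ →L[ℂ] K₂) : unitaryConj U₁ U₂ (unitaryConj U₁.symm U₂.symm T) = T := by
  ext ξ; simp [unitaryConj_apply]

theorem continuous_unitaryConj (U₁ : H₁ ≃ₗᵢ[ℂ] K₁) (U₂ : H₂ ≃ₗᵢ[ℂ] K₂) :
    @Continuous _ _ (weakStarTopology H₁ H₂) (weakStarTopology K₁ K₂) (unitaryConj U₁ U₂) :=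
  continuous_weakStar_comp_comp _ _

omit [CompleteSpace H₂] [CompleteSpace K₂] in
-- The amplified map multiplies by the diagonal unitaries with entries `U₂` and `U₁*`. Applying the
-- inequality to the inverses as well gives equality.
theorem norm_matrixOp_unitaryConj_le (U₁ : H₁ ≃ₗᵢ[ℂ] K₁) (U₂ : H₂ ≃ₗᵢ[ℂ] K₂) {n : ℕ}
    (T : Matrix (Fin n) (Fin n) (H₁ →L[ℂ] H₂)) :
    ‖matrixOp (T.map (unitaryConj U₁ U₂))‖ ≤ ‖matrixOp T‖ := by
  refine opNorm_le_bound _ (opNorm_nonneg _) fun v => ?_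
  let w : PiLp 2 (fun _ : Fin n => H₁) := WithLp.toLp 2 fun i => U₁.symm (v i)
  have h1 : ‖w‖ = ‖v‖ := by
    simp [PiLp.norm_eq_of_L2, w]
  have h2 : ‖matrixOp (T.map (unitaryConj U₁ U₂)) v‖ = ‖matrixOp T w‖ := by
    rw [PiLp.norm_eq_of_L2, PiLp.norm_eq_of_L2]
    congr 1
    refine Finset.sum_congr rfl fun i _ => ?_
    rw [matrixOp_apply, matrixOp_apply]
    simp only [Matrix.map_apply, unitaryConj_apply, w, ← map_sum, LinearIsometryEquiv.norm_map]
  rw [h2, ← h1]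
  exact le_opNorm _ _

omit [CompleteSpace H₂] [CompleteSpace K₂] in
theorem norm_matrixOp_unitaryConj (U₁ : H₁ ≃ₗᵢ[ℂ] K₁) (U₂ : H₂ ≃ₗᵢ[ℂ] K₂) {n : ℕ}
    (T : Matrix (Fin n) (Fin n) (H₁ →L[ℂ] H₂)) :
    ‖matrixOp (T.map (unitaryConj U₁ U₂))‖ = ‖matrixOp T‖ := by
  refine le_antisymm (norm_matrixOp_unitaryConj_le U₁ U₂ T) ?_
  have := norm_matrixOp_unitaryConj_le U₁.symm U₂.symm (T.map (unitaryConj U₁ U₂))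
  rwa [Matrix.map_map, show unitaryConj U₁.symm U₂.symm ∘ unitaryConj U₁ U₂ = id from
    funext (unitaryConj_symm_unitaryConj U₁ U₂), Matrix.map_id] at this

theorem exists_isDualOperatorSpaceIso {X : Submodule ℂ (H₁ →L[ℂ] H₂)}
    {Y : Submodule ℂ (K₁ →L[ℂ] K₂)} (U₁ : H₁ ≃ₗᵢ[ℂ] K₁) (U₂ : H₂ ≃ₗᵢ[ℂ] K₂)
    (h : ∀ T ∈ X, unitaryConj U₁ U₂ T ∈ Y) (h' : ∀ T ∈ Y, unitaryConj U₁.symm U₂.symm T ∈ X) :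
    ∃ φ : X ≃ₗ[ℂ] Y, IsDualOperatorSpaceIso φ ∧
      ∀ T, (φ T : K₁ →L[ℂ] K₂) = unitaryConj U₁ U₂ T := by
  let φ : X ≃ₗ[ℂ] Y :=
    { toFun := fun T => ⟨unitaryConj U₁ U₂ T, h T T.2⟩
      invFun := fun T => ⟨unitaryConj U₁.symm U₂.symm T, h' T T.2⟩
      map_add' := fun S T => by
        ext ξ; simp [unitaryConj_apply]
      map_smul' := fun c T => by
        ext ξ; simp [unitaryConj_apply]
      left_inv := fun T => Subtype.ext (unitaryConj_symm_unitaryConj U₁ U₂ T)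
      right_inv := fun T => Subtype.ext (unitaryConj_unitaryConj_symm U₁ U₂ T) }
  refine ⟨φ, ⟨fun n T => ?_, ?_⟩, fun T => rfl⟩
  · exact norm_matrixOp_unitaryConj U₁ U₂ (T.map fun x => (x : H₁ →L[ℂ] H₂))
  · let _ := weakStarTopology H₁ H₂
    let _ := weakStarTopology K₁ K₂
    let _ := relWeakStarTopology X
    let _ := relWeakStarTopology Y
    exact Homeomorph.isHomeomorph
      { φ.toEquiv with
        continuous_toFun := continuous_induced_rng.2
          ((continuous_unitaryConj U₁ U₂).comp continuous_induced_dom)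
        continuous_invFun := continuous_induced_rng.2
          ((continuous_unitaryConj U₁.symm U₂.symm).comp continuous_induced_dom) }

end Conj

/-! ### Unitary equivalence of the stabilizations -/

section Unitaries

variable {H₁ H₂ K₁ K₂ : Type*}
  [NormedAddCommGroup H₁] [InnerProductSpace ℂ H₁] [CompleteSpace H₁]
  [NormedAddCommGroup H₂] [InnerProductSpace ℂ H₂] [CompleteSpace H₂]
  [NormedAddCommGroup K₁] [InnerProductSpace ℂ K₁] [CompleteSpace K₁]
  [NormedAddCommGroup K₂] [InnerProductSpace ℂ K₂] [CompleteSpace K₂]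
  {J : Type*}

omit [CompleteSpace H₂] [CompleteSpace K₂] in
theorem comp_comp_adjoint_mem_stabilization {X : Submodule ℂ (H₁ →L[ℂ] H₂)}
    {Y : Submodule ℂ (K₁ →L[ℂ] K₂)} {N₁ : Submodule ℂ (H₁ →L[ℂ] K₁)}
    {N₂ : Submodule ℂ (H₂ →L[ℂ] K₂)} (h : ∀ b ∈ N₂, ∀ x ∈ X, ∀ a ∈ N₁, b ∘L x ∘L adjoint a ∈ Y)
    {B : HilbertTensor H₂ (ellTwo J) →L[ℂ] HilbertTensor K₂ (ellTwo J)}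
    (hB : B ∈ stabilization N₂ J)
    {T : HilbertTensor H₁ (ellTwo J) →L[ℂ] HilbertTensor H₂ (ellTwo J)}
    (hT : T ∈ stabilization X J)
    {A : HilbertTensor H₁ (ellTwo J) →L[ℂ] HilbertTensor K₁ (ellTwo J)}
    (hA : A ∈ stabilization N₁ J) : B ∘L T ∘L adjoint A ∈ stabilization Y J := by
  refine comp_comp_adjoint_mem (isWeakStarClosed_weakStarSpan _) ?_ hB hT hA
  rintro _ ⟨b, hb, β, rfl⟩ _ ⟨x, hx, χ, rfl⟩ _ ⟨a, ha, α, rfl⟩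
  rw [adjoint_tensorOp, tensorOp_comp, tensorOp_comp]
  exact tensorOp_mem_stabilization (h b hb x hx a ha) _

omit [CompleteSpace H₁] [CompleteSpace K₁] in
theorem adjoint_comp_comp_mem_stabilization {X : Submodule ℂ (H₁ →L[ℂ] H₂)}
    {Y : Submodule ℂ (K₁ →L[ℂ] K₂)} {N₁ : Submodule ℂ (H₁ →L[ℂ] K₁)}
    {N₂ : Submodule ℂ (H₂ →L[ℂ] K₂)} (h : ∀ b ∈ N₂, ∀ y ∈ Y, ∀ a ∈ N₁, adjoint b ∘L y ∘L a ∈ X)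
    {B : HilbertTensor H₂ (ellTwo J) →L[ℂ] HilbertTensor K₂ (ellTwo J)}
    (hB : B ∈ stabilization N₂ J)
    {T : HilbertTensor K₁ (ellTwo J) →L[ℂ] HilbertTensor K₂ (ellTwo J)}
    (hT : T ∈ stabilization Y J)
    {A : HilbertTensor H₁ (ellTwo J) →L[ℂ] HilbertTensor K₁ (ellTwo J)}
    (hA : A ∈ stabilization N₁ J) : adjoint B ∘L T ∘L A ∈ stabilization X J := by
  refine adjoint_comp_comp_mem (isWeakStarClosed_weakStarSpan _) ?_ hB hT hA
  rintro _ ⟨b, hb, β, rfl⟩ _ ⟨y, hy, χ, rfl⟩ _ ⟨a, ha, α, rfl⟩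
  rw [adjoint_tensorOp, tensorOp_comp, tensorOp_comp]
  exact tensorOp_mem_stabilization (h b hb y hy a ha) _

theorem unitaryConj_symm_eq (U₁ : H₁ ≃ₗᵢ[ℂ] K₁) (U₂ : H₂ ≃ₗᵢ[ℂ] K₂) (T : K₁ →L[ℂ] K₂) :
    unitaryConj U₁.symm U₂.symm T =
      adjoint (U₂ : H₂ →L[ℂ] K₂) ∘L T ∘L (U₁ : H₁ →L[ℂ] K₁) := by
  ext ξ
  rw [unitaryConj_apply, LinearIsometryEquiv.adjoint_eq_symm]
  rfl

/-- The stabilizations of nondegenerate TRO-equivalent spaces over a large index set are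
unitarily equivalent. -/
theorem TROEquivalent.exists_unitaryConj {X : Submodule ℂ (H₁ →L[ℂ] H₂)}
    {Y : Submodule ℂ (K₁ →L[ℂ] K₂)} (hXY : TROEquivalent X Y)
    (hX : IsWeakStarClosed X) (hY : IsWeakStarClosed Y)
    (hXnd : ActsNondegenerately X) (hYnd : ActsNondegenerately Y)
    {J : Type*} [Infinite J] (f₁ : (H₁ →L[ℂ] K₁) ↪ J) (g₁ : (K₁ →L[ℂ] H₁) ↪ J)
    (f₂ : (H₂ →L[ℂ] K₂) ↪ J) (g₂ : (K₂ →L[ℂ] H₂) ↪ J) :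
    ∃ (U₁ : HilbertTensor H₁ (ellTwo J) ≃ₗᵢ[ℂ] HilbertTensor K₁ (ellTwo J))
      (U₂ : HilbertTensor H₂ (ellTwo J) ≃ₗᵢ[ℂ] HilbertTensor K₂ (ellTwo J)),
      (∀ T ∈ stabilization X J, unitaryConj U₁ U₂ T ∈ stabilization Y J) ∧
      ∀ T ∈ stabilization Y J, unitaryConj U₁.symm U₂.symm T ∈ stabilization X J := by
  obtain ⟨M₁, M₂, hM₁, hM₂, hYeq, hXeq⟩ := hXY
  have hYmem : ∀ b ∈ M₂, ∀ x ∈ X, ∀ a ∈ M₁, b ∘L x ∘L adjoint a ∈ Y := fun b hb x hx a ha => by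
    rw [hYeq]; exact subset_weakStarSpan _ ⟨b, hb, x, hx, a, ha, rfl⟩
  have hXmem : ∀ b ∈ M₂, ∀ y ∈ Y, ∀ a ∈ M₁, adjoint b ∘L y ∘L a ∈ X := fun b hb y hy a ha => by
    rw [hXeq]; exact subset_weakStarSpan _ ⟨b, hb, y, hy, a, ha, rfl⟩
  -- `X` is generated by `M₂* Y M₁`, so a vector killed by `M₁` is killed by `X`, and one killed by
  -- `M₂` is orthogonal to the range of `X`. Nondegeneracy then makes it zero. `hY0` does the same
  -- for `M₁*` and `M₂*`.
  have hX0 : ∀ ξ η, (∀ b ∈ M₂, ∀ y ∈ Y, ∀ a ∈ M₁, ⟪η, adjoint b (y (a ξ))⟫_ℂ = 0) →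
      ∀ x ∈ X, ⟪η, x ξ⟫_ℂ = 0 := fun ξ η h x hx => by
    rw [hXeq] at hx
    refine inner_eq_zero_of_mem_weakStarSpan ?_ hx
    rintro _ ⟨b, hb, y, hy, a, ha, rfl⟩
    exact h b hb y hy a ha
  have hY0 : ∀ ξ η, (∀ b ∈ M₂, ∀ x ∈ X, ∀ a ∈ M₁, ⟪η, b (x (adjoint a ξ))⟫_ℂ = 0) →
      ∀ y ∈ Y, ⟪η, y ξ⟫_ℂ = 0 := fun ξ η h y hy => by
    rw [hYeq] at hy
    refine inner_eq_zero_of_mem_weakStarSpan ?_ hy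
    rintro _ ⟨b, hb, x, hx, a, ha, rfl⟩
    exact h b hb x hx a ha
  obtain ⟨U₁, hU₁⟩ := exists_unitary_mem_stabilization (J := J)
    (isWeakStarClosed_weakStarSpan (M₁ : Set (H₁ →L[ℂ] K₁))) hM₁.weakStarSpan
    (fun ξ h => hXnd.eq_zero fun x hx η => hX0 ξ η (fun b _ y _ a ha => by
      rw [h a (subset_weakStarSpan _ ha)]; simp) x hx)
    (fun ξ h => hYnd.eq_zero fun y hy η => hY0 ξ η (fun b _ x _ a ha => by
      rw [h a (subset_weakStarSpan _ ha)]; simp) y hy)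
    f₁ g₁
  obtain ⟨U₂, hU₂⟩ := exists_unitary_mem_stabilization (J := J)
    (isWeakStarClosed_weakStarSpan (M₂ : Set (H₂ →L[ℂ] K₂))) hM₂.weakStarSpan
    (fun η h => hXnd.eq_zero' fun x hx ξ => hX0 ξ η (fun b hb y _ a _ => by
      rw [adjoint_inner_right, h b (subset_weakStarSpan _ hb), inner_zero_left]) x hx)
    (fun η h => hYnd.eq_zero' fun y hy ξ => hY0 ξ η (fun b hb x _ a _ => by
      rw [← adjoint_inner_left, h b (subset_weakStarSpan _ hb), inner_zero_left]) y hy)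
    f₂ g₂
  have hY' : ∀ b ∈ weakStarSpan (M₂ : Set (H₂ →L[ℂ] K₂)), ∀ x ∈ X,
      ∀ a ∈ weakStarSpan (M₁ : Set (H₁ →L[ℂ] K₁)), b ∘L x ∘L adjoint a ∈ Y :=
    fun b hb x hx a ha =>
      comp_comp_adjoint_mem hY hYmem hb (subset_weakStarSpan (X : Set (H₁ →L[ℂ] H₂)) hx) ha
  have hX' : ∀ b ∈ weakStarSpan (M₂ : Set (H₂ →L[ℂ] K₂)), ∀ y ∈ Y,
      ∀ a ∈ weakStarSpan (M₁ : Set (H₁ →L[ℂ] K₁)), adjoint b ∘L y ∘L a ∈ X :=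
    fun b hb y hy a ha =>
      adjoint_comp_comp_mem hX hXmem hb (subset_weakStarSpan (Y : Set (K₁ →L[ℂ] K₂)) hy) ha
  refine ⟨U₁, U₂, fun T hT => ?_, fun T hT => ?_⟩
  · exact comp_comp_adjoint_mem_stabilization hY' hU₂ hT hU₁
  · rw [unitaryConj_symm_eq]
    exact adjoint_comp_comp_mem_stabilization hX' hU₂ hT hU₁

end Unitaries

end TROStable

/-! ### The main theorem -/

theorem mainTheorem1
    {H₁ : Type u₁} {H₂ : Type u₂} {K₁ : Type v₁} {K₂ : Type v₂}
    [NormedAddCommGroup H₁] [InnerProductSpace ℂ H₁] [CompleteSpace H₁]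
    [NormedAddCommGroup H₂] [InnerProductSpace ℂ H₂] [CompleteSpace H₂]
    [NormedAddCommGroup K₁] [InnerProductSpace ℂ K₁] [CompleteSpace K₁]
    [NormedAddCommGroup K₂] [InnerProductSpace ℂ K₂] [CompleteSpace K₂]
    (X : Submodule ℂ (H₁ →L[ℂ] H₂)) (Y : Submodule ℂ (K₁ →L[ℂ] K₂))
    (hX : IsWeakStarClosed X) (hY : IsWeakStarClosed Y)
    (hXnd : ActsNondegenerately X) (hYnd : ActsNondegenerately Y)
    (hXY : TROEquivalent X Y) :
    (∃ (J : Type (max u₁ u₂ v₁ v₂)) (_ : Infinite J)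
      (U₁ : HilbertTensor H₁ (ellTwo J) ≃ₗᵢ[ℂ] HilbertTensor K₁ (ellTwo J))
      (U₂ : HilbertTensor H₂ (ellTwo J) ≃ₗᵢ[ℂ] HilbertTensor K₂ (ellTwo J)),
      unitaryConj U₁ U₂ '' (stabilization X J : Set _) = (stabilization Y J : Set _) ∧
      ∃ φ : stabilization X J ≃ₗ[ℂ] stabilization Y J,
        IsDualOperatorSpaceIso φ ∧ ∀ T, (φ T : _ →L[ℂ] _) = unitaryConj U₁ U₂ T) ∧
    StablyIsomorphic X Y := by
  -- The four operator spaces embed in `J` as coordinates, so `J` can index any partition drawn from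
  -- them; the factor `ℕ` makes it infinite.
  let J : Type (max u₁ u₂ v₁ v₂) :=
    ℕ × (H₁ →L[ℂ] K₁) × (K₁ →L[ℂ] H₁) × (H₂ →L[ℂ] K₂) × (K₂ →L[ℂ] H₂)
  have hJ : Infinite J := Prod.infinite_of_left
  obtain ⟨U₁, U₂, hmaps, hmaps'⟩ := hXY.exists_unitaryConj hX hY hXnd hYnd (J := J)
    ⟨fun T => (0, T, 0, 0, 0), fun S T h => congrArg (fun p : J => p.2.1) h⟩
    ⟨fun T => (0, 0, T, 0, 0), fun S T h => congrArg (fun p : J => p.2.2.1) h⟩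
    ⟨fun T => (0, 0, 0, T, 0), fun S T h => congrArg (fun p : J => p.2.2.2.1) h⟩
    ⟨fun T => (0, 0, 0, 0, T), fun S T h => congrArg (fun p : J => p.2.2.2.2) h⟩
  obtain ⟨φ, hφ, hφU⟩ := exists_isDualOperatorSpaceIso U₁ U₂ hmaps hmaps'
  refine ⟨⟨J, hJ, U₁, U₂, ?_, φ, hφ, hφU⟩, J, inferInstance, φ, hφ⟩
  refine Set.Subset.antisymm (Set.image_subset_iff.2 hmaps) fun T hT => ?_
  exact ⟨_, hmaps' T hT, unitaryConj_unitaryConj_symm U₁ U₂ T⟩
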